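/- **Theorem 2 (Tradeoff Theorem for local commuting projector codes).** Place one qubit at each vertex of a $D$-dimensional hypercubic lattice of linear size $L$, with open or periodic boundary conditions. A *local commuting projector code* with interaction range $w$ is given by a set of mutually commuting orthogonal projectors, each acting nontrivially only inside some hypercube of linear size $w$; its code space is the simultaneous eigenspace with eigenvalue one of these projectors. A set of qubits $M$ is *correctable* if erasure of the qubits in $M$ can be reversed, for all states of the code, by a trace-preserving completely positive recovery map, and the *distance* $d$ is the minimum size of a noncorrectable set of qubits (assumed to exist). A *logical operator* is a linear operator that maps the code space into itself; two logical operators are *equivalent* if they act in the same way on the code space; the *weight* of an operator is the number of qubits on which it acts nontrivially. For all integers $D\ge 2$ and $w>1$ there is a constant $c>0$, depending only on $D$ and $w$, such that for every $L$ and every local commuting projector code with interaction range $w$ and distance $d$ on the $D$-dimensional lattice of linear size $L$: 1. every logical operator is equivalent to a logical operator whose weight $\tilde d$ satisfies $$\tilde d\, d^{1/(D-1)} < c\, L^D ;$$ 2. consequently $d = O(L^{D-1})$: one has $d \le c\, L^{D-1}$. -/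

import Mathlib

namespace QubitCode

open scoped ComplexOrder

/-! ### Qubits, operators, supports, and erasure -/

/-- Labels of the computational basis of the Hilbert space `(ℂ²)^{⊗ Λ}` of qubits at the sites of
`Λ`. -/
abbrev Config (Λ : Type) : Type := Λ → Fin 2

/-- Linear operators on `(ℂ²)^{⊗ Λ}`, as matrices in the computational basis. -/
abbrev Operator (Λ : Type) : Type := Matrix (Config Λ) (Config Λ) ℂ

section General

variable {Λ : Type} [Fintype Λ] [DecidableEq Λ]

/-- The operator `B ⊗ I` on all qubits, where `B` acts on the qubits in `M` and the identity acts
on the complement of `M`. -/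
def tensorId (M : Finset Λ) (B : Operator {i // i ∈ M}) : Operator Λ :=
  Matrix.of fun s t =>
    if ∀ i, i ∉ M → s i = t i then B (fun i => s i) (fun i => t i) else 0

/-- `O` acts nontrivially only on qubits in `M`. -/
def SupportedOn (O : Operator Λ) (M : Finset Λ) : Prop :=
  ∃ B : Operator {i // i ∈ M}, O = tensorId M B

open Classical in
/-- The set of qubits on which `O` acts nontrivially, i.e. the qubits `i` such that `O` is not of
the form `O' ⊗ I` with `I` the identity on qubit `i`. -/
noncomputable def opSupport (O : Operator Λ) : Finset Λ :=
  Finset.univ.filter fun i => ¬ SupportedOn O {i}ᶜ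

/-- The weight of an operator: the number of qubits on which it acts nontrivially. -/
noncomputable def weight (O : Operator Λ) : ℕ := (opSupport O).card

/-- Combine a configuration on `M` and a configuration on the complement of `M`. -/
def glue (M : Finset Λ) (m : Config {i // i ∈ M}) (s : Config {i // i ∉ M}) : Config Λ :=
  fun i => if h : i ∈ M then m ⟨i, h⟩ else s ⟨i, h⟩

/-- The partial trace over the qubits in `M`, i.e. the erasure of the qubits in `M`: a state of all
qubits is mapped to the state of the remaining ones. -/
def partialTrace (M : Finset Λ) (ρ : Operator Λ) : Operator {i // i ∉ M} :=
  Matrix.of fun s t => ∑ m : Config {i // i ∈ M}, ρ (glue M m s) (glue M m t)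

end General

/-- A linear map `R` between matrix algebras is completely positive: for every `k`, the map
`id_k ⊗ R` sends positive semidefinite matrices to positive semidefinite matrices. -/
def IsCompletelyPositive {m n : Type} (R : Matrix m m ℂ →ₗ[ℂ] Matrix n n ℂ) : Prop :=
  ∀ (k : ℕ) (X : Matrix (Fin k × m) (Fin k × m) ℂ), X.PosSemidef →
    (Matrix.of fun (a b : Fin k × n) =>
      R (Matrix.of fun i j => X (a.1, i) (b.1, j)) a.2 b.2).PosSemidef

/-- `R` preserves the trace. -/
def IsTracePreserving {m n : Type} [Fintype m] [Fintype n]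
    (R : Matrix m m ℂ →ₗ[ℂ] Matrix n n ℂ) : Prop :=
  ∀ X, (R X).trace = X.trace

section CodeSpace

variable {Λ : Type} [Fintype Λ] [DecidableEq Λ]

/-- `ρ` is a (pure or mixed) state, i.e. a density operator, of the code with code space `C`. -/
def IsCodeState (C : Submodule ℂ (Config Λ → ℂ)) (ρ : Operator Λ) : Prop :=
  ρ.PosSemidef ∧ ρ.trace = 1 ∧ ∀ v : Config Λ → ℂ, ρ.mulVec v ∈ C

/-- A set `M` of qubits is correctable for the code space `C` if the erasure of the qubits in `M`
can be reversed by a trace-preserving completely positive recovery map. -/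
def IsCorrectable (C : Submodule ℂ (Config Λ → ℂ)) (M : Finset Λ) : Prop :=
  ∃ R : Operator {i // i ∉ M} →ₗ[ℂ] Operator Λ,
    IsCompletelyPositive R ∧ IsTracePreserving R ∧
      ∀ ρ, IsCodeState C ρ → R (partialTrace M ρ) = ρ

/-- `d` is the distance of the code: the minimum size of a noncorrectable set of qubits. -/
def IsDistance (C : Submodule ℂ (Config Λ → ℂ)) (d : ℕ) : Prop :=
  IsLeast {m : ℕ | ∃ M : Finset Λ, ¬ IsCorrectable C M ∧ M.card = m} d

/-- A logical operator is a linear operator that preserves the code space. -/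
def IsLogical (C : Submodule ℂ (Config Λ → ℂ)) (W : Operator Λ) : Prop :=
  ∀ ψ ∈ C, W.mulVec ψ ∈ C

/-- Two operators are equivalent if they act in the same way on the code space. -/
def Equivalent (C : Submodule ℂ (Config Λ → ℂ)) (W V : Operator Λ) : Prop :=
  ∀ ψ ∈ C, W.mulVec ψ = V.mulVec ψ

end CodeSpace

/-! ### Local commuting projector codes on a hypercubic lattice -/

/-- The sites of the `D`-dimensional hypercubic lattice with linear size `L`. -/
abbrev Site (D L : ℕ) : Type := Fin D → Fin L

/-- The two kinds of boundary conditions of the lattice. -/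
inductive Boundary
  | openBoundary
  | periodicBoundary

/-- The hypercube of linear size `w` with corner `a`: the sites whose `j`-th coordinate is one of
`a j, a j + 1, …, a j + w - 1` for every `j`, where for periodic boundary conditions these numbers
are read modulo `L`. -/
def hypercube {D L : ℕ} : Boundary → ℕ → (Fin D → ℕ) → Finset (Site D L)
  | .openBoundary, w, a => Finset.univ.filter fun x => ∀ j, ∃ k < w, (x j : ℕ) = a j + k
  | .periodicBoundary, w, a => Finset.univ.filter fun x => ∀ j, ∃ k < w, (x j : ℕ) = (a j + k) % L

/-- A local commuting projector code with interaction range `w`, with one qubit at each site of the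
`D`-dimensional hypercubic lattice with linear size `L`: a set of mutually commuting orthogonal
projectors, each of which acts nontrivially only inside some hypercube of linear size `w`. -/
structure LocalCommutingProjectorCode (D L w : ℕ) (bc : Boundary) where
  /-- The projectors. -/
  projectors : Finset (Operator (Site D L))
  isProjector : ∀ P ∈ projectors, IsStarProjection P
  commute : ∀ P ∈ projectors, ∀ Q ∈ projectors, Commute P Q
  isLocal : ∀ P ∈ projectors, ∃ a : Fin D → ℕ, SupportedOn P (hypercube bc w a)

/-- The code space: the simultaneous eigenspace with eigenvalue one of the projectors. -/
def LocalCommutingProjectorCode.codeSpace {D L w : ℕ} {bc : Boundary}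
    (S : LocalCommutingProjectorCode D L w bc) : Submodule ℂ (Config (Site D L) → ℂ) where
  carrier := {ψ | ∀ P ∈ S.projectors, P.mulVec ψ = ψ}
  add_mem' := fun hx hy P hP => by rw [Matrix.mulVec_add, hx P hP, hy P hP]
  zero_mem' := fun P _ => Matrix.mulVec_zero P
  smul_mem' := fun c x hx P hP => by rw [Matrix.mulVec_smul, hx P hP]

end QubitCode

open QubitCode

/-!
The code space `C` is handled through the Knill-Laflamme condition for a set `M` of qubits: every
operator on `M`, compressed to `C`, is a scalar. Correctable sets satisfy it
(`IsCorrectable.knillLaflamme`): each Kraus operator of "erase `M`, then recover" acts on `C` as a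
scalar. If the whole lattice satisfies it, then the code has at most one state and every set is
correctable, which the existence of a distance excludes. Three facts about commuting projectors
carry the argument.

* Cleaning (`KnillLaflamme.exists_equivalent`): if `M` satisfies the condition, then every logical
  operator is equivalent to one on the complement of `M`, namely the one that maps `⟨m|v` to `⟨m|Xv`
  for `v ∈ C` and each basis state `m` of `M`; the condition makes this well defined.
* Union (`KnillLaflamme.union`): disjoint sets on which no projector acts jointly have a union that
  satisfies the condition. This rests on decoupling (`star_dotProduct_mulVec_mulVec`): if each
  projector commutes with `A` or with `B`, then the scalar of `A` factors out of the compression of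
  `A * B`, because the projection onto `C` is a product of a part commuting with `A` and a part
  commuting with `B`.
* Expansion (`KnillLaflamme.expand`): `M ∪ A` satisfies the condition if `M` and `A` do and the
  projectors touching `M` act inside `M ∪ A`. By decoupling, `M` stays correctable for the larger
  code `E` spanned by the code states after arbitrary operations on the complement of `M ∪ A`. An
  operator on `M ∪ A`, compressed to `E`, can therefore be cleaned off `M`, and becomes an operator
  on `A`.

Sets of fewer than `d` qubits are correctable. By expansion, so is a box of side `l` as soon as its
boundary layer of width `w`, of size at most `2 w D l ^ (D - 1)`, has fewer than `d` sites. For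
`l = L` this box is the whole lattice, so `d ≤ 2 w D L ^ (D - 1)`. For `l` of the order of
`d ^ (1 / (D - 1))`, the lattice is filled, up to margins of relative size `O(w D / l)`, by boxes of
side at most `l` too far apart for a projector to act on two of them. By the union lemma they form
one correctable set, and cleaning it leaves logical operators of weight
`O(L ^ D / l) = O(L ^ D / d ^ (1 / (D - 1)))`.
-/

namespace QubitCode

open Matrix

open scoped ComplexOrder

/-! ### Supports of operators -/

section Support

variable {Λ : Type} [Fintype Λ] [DecidableEq Λ]

lemma tensorId_apply (M : Finset Λ) (B : Operator {i // i ∈ M}) (s t : Config Λ) :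
    tensorId M B s t = if ∀ i, i ∉ M → s i = t i then B (fun i => s i) (fun i => t i) else 0 := rfl

/-- A product of two operators whose supports are disjoint has a single nonzero summand in each
entry, indexed by the configuration that agrees with the column index on the first support and
with the row index elsewhere. -/
lemma tensorId_mul_tensorId_apply {M N : Finset Λ} (h : Disjoint M N)
    (A : Operator {i // i ∈ M}) (B : Operator {i // i ∈ N}) (s t : Config Λ) :
    (tensorId M A * tensorId N B) s t =
      if ∀ i, i ∉ M → i ∉ N → s i = t i then
        A (fun i => s i) (fun i => t i) * B (fun i => s i) (fun i => t i) else 0 := by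
  have hMN : ∀ i, i ∈ M → i ∉ N := fun i hi hj => Finset.disjoint_left.mp h hi hj
  rw [Matrix.mul_apply, Finset.sum_eq_single (fun i => if i ∈ M then t i else s i)]
  · have h1 : (fun i : {i // i ∈ M} => if (i : Λ) ∈ M then t i else s i) =
        fun i : {i // i ∈ M} => t i := by
      funext i; simp
    have h2 : (fun i : {i // i ∈ N} => if (i : Λ) ∈ M then t i else s i) =
        fun i : {i // i ∈ N} => s i := by
      funext i
      have : (i : Λ) ∉ M := fun hi => hMN _ hi i.2
      simp [this]
    have h3 : (∀ i, i ∉ M → s i = if i ∈ M then t i else s i) := fun i hi => by simp [hi]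
    have h4 : (∀ i, i ∉ N → (if i ∈ M then t i else s i) = t i) ↔
        ∀ i, i ∉ M → i ∉ N → s i = t i := by
      refine forall_congr' fun i => ?_
      by_cases hi : i ∈ M <;> simp [hi]
    rw [tensorId_apply, tensorId_apply, if_pos h3, h1, h2]
    simp only [h4]
    split_ifs <;> simp
  · intro r _ hr
    rw [tensorId_apply, tensorId_apply]
    split_ifs with h1 h2
    · exfalso
      apply hr
      funext i
      by_cases hi : i ∈ M
      · simp [hi, h2 i (hMN i hi)]
      · simp [hi, h1 i hi]
    · simp
    · simp
    · simp
  · simp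

lemma SupportedOn.commute {O P : Operator Λ} {M N : Finset Λ} (hO : SupportedOn O M)
    (hP : SupportedOn P N) (h : Disjoint M N) : Commute O P := by
  obtain ⟨A, rfl⟩ := hO
  obtain ⟨B, rfl⟩ := hP
  ext s t
  rw [tensorId_mul_tensorId_apply h, tensorId_mul_tensorId_apply h.symm]
  refine if_ctx_congr ⟨fun H i h1 h2 => H i h2 h1, fun H i h1 h2 => H i h2 h1⟩ ?_ fun _ => rfl
  exact fun _ => mul_comm _ _

/-- Operators commuting with every operator on a single site outside `M` act on `M` only. -/
lemma supportedOn_of_commute {O : Operator Λ} {M : Finset Λ}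
    (h : ∀ i, i ∉ M → ∀ P, SupportedOn P {i} → Commute O P) : SupportedOn O M := by
  have key : ∀ i, i ∉ M → ∀ (s t : Config Λ) (y : Fin 2),
      O (Function.update s i y) t = if t i = y then O s (Function.update t i (s i)) else 0 := by
    intro i hi s t y
    -- compare the entries of `O` times the matrix unit `|s i⟩⟨y|` at site `i`
    set F : Operator Λ := tensorId {i} (Matrix.single (fun _ => s i) (fun _ => y) 1) with hF
    have hFa : ∀ a b : Config Λ, F a b =
        if (∀ j, j ≠ i → a j = b j) ∧ a i = s i ∧ b i = y then 1 else 0 := by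
      intro a b
      have e1 : ((fun _ => s i) = fun k : {j // j ∈ ({i} : Finset Λ)} => a k) ↔ a i = s i := by
        constructor
        · intro H; exact (congrFun H ⟨i, by simp⟩).symm
        · intro H; funext ⟨k, hk⟩; obtain rfl := Finset.mem_singleton.mp hk; exact H.symm
      have e2 : ((fun _ => y) = fun k : {j // j ∈ ({i} : Finset Λ)} => b k) ↔ b i = y := by
        constructor
        · intro H; exact (congrFun H ⟨i, by simp⟩).symm
        · intro H; funext ⟨k, hk⟩; obtain rfl := Finset.mem_singleton.mp hk; exact H.symm
      rw [hF, tensorId_apply]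
      simp only [Finset.mem_singleton, Matrix.single_apply, e1, e2]
      split_ifs <;> simp_all
    have hc := congrFun (congrFun (h i hi F ⟨_, rfl⟩).eq s) t
    rw [Matrix.mul_apply, Matrix.mul_apply, Finset.sum_eq_single (Function.update t i (s i)),
      Finset.sum_eq_single (Function.update s i y), hFa, hFa] at hc
    · rw [if_pos (c := _ ∧ s i = s i ∧ _)
        ⟨fun j hj => by rw [Function.update_of_ne hj], rfl, Function.update_self ..⟩] at hc
      rw [one_mul] at hc
      rw [← hc]
      by_cases hty : t i = y
      · rw [if_pos hty, if_pos ⟨fun j hj => by rw [Function.update_of_ne hj],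
          Function.update_self .., hty⟩, mul_one]
      · rw [if_neg hty, if_neg (fun h => hty h.2.2), mul_zero]
    · intro b _ hb
      rw [hFa, if_neg, zero_mul]
      rintro ⟨h1, -, h2⟩
      apply hb
      funext j
      by_cases hj : j = i
      · subst hj; simp [h2]
      · simp [hj, h1 j hj]
    · simp
    · intro b _ hb
      rw [hFa, if_neg, mul_zero]
      rintro ⟨h1, h2, -⟩
      apply hb
      funext j
      by_cases hj : j = i
      · subst hj; simp [h2]
      · simp [hj, h1 j hj]
    · simp
  have hzero : ∀ i, i ∉ M → ∀ s t : Config Λ, s i ≠ t i → O s t = 0 := by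
    intro i hi s t hst
    have := key i hi s t (s i)
    rwa [Function.update_eq_self, if_neg (Ne.symm hst)] at this
  have hupd : ∀ i, i ∉ M → ∀ (s t : Config Λ) (y : Fin 2), s i = t i →
      O (Function.update s i y) (Function.update t i y) = O s t := by
    intro i hi s t y hst
    rw [key i hi, Function.update_self, if_pos rfl, Function.update_idem, hst,
      Function.update_eq_self]
  have hpw : ∀ (S : Finset Λ), (∀ i ∈ S, i ∉ M) → ∀ s t : Config Λ, (∀ i, i ∉ M → s i = t i) →
      O (S.piecewise 0 s) (S.piecewise 0 t) = O s t := by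
    intro S
    induction S using Finset.induction_on with
    | empty => intro _ s t _; simp
    | insert i S hiS ih =>
      intro hS s t hst
      rw [Finset.piecewise_insert, Finset.piecewise_insert]
      have hi : i ∉ M := hS i (Finset.mem_insert_self _ _)
      have e := hupd i hi (S.piecewise 0 s) (S.piecewise 0 t) 0 (by simp [hiS, hst i hi])
      exact e.trans (ih (fun j hj => hS j (Finset.mem_insert_of_mem hj)) s t hst)
  refine ⟨Matrix.of fun m m' => O (fun i => if h : i ∈ M then m ⟨i, h⟩ else 0)
    (fun i => if h : i ∈ M then m' ⟨i, h⟩ else 0), ?_⟩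
  ext s t
  rw [tensorId_apply]
  split_ifs with hst
  · rw [← hpw Mᶜ (by simp) s t hst, Matrix.of_apply]
    congr 1 <;> funext i <;> by_cases hi : i ∈ M <;> simp [hi, Finset.piecewise]
  · push Not at hst
    obtain ⟨i, hi, hne⟩ := hst
    exact hzero i hi s t hne

lemma supportedOn_iff_commute {O : Operator Λ} {M : Finset Λ} :
    SupportedOn O M ↔ ∀ i, i ∉ M → ∀ P, SupportedOn P {i} → Commute O P :=
  ⟨fun h _ hi _ hP => h.commute hP (by simpa using hi), supportedOn_of_commute⟩

lemma SupportedOn.mono {O : Operator Λ} {M N : Finset Λ} (h : SupportedOn O M) (hMN : M ⊆ N) :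
    SupportedOn O N :=
  supportedOn_of_commute fun i hi => supportedOn_iff_commute.mp h i fun hm => hi (hMN hm)

lemma SupportedOn.mul {O P : Operator Λ} {M : Finset Λ} (hO : SupportedOn O M)
    (hP : SupportedOn P M) : SupportedOn (O * P) M :=
  supportedOn_of_commute fun i hi Q hQ =>
    (supportedOn_iff_commute.mp hO i hi Q hQ).mul_left (supportedOn_iff_commute.mp hP i hi Q hQ)

lemma SupportedOn.conjTranspose {O : Operator Λ} {M : Finset Λ} (hO : SupportedOn O M) :
    SupportedOn Oᴴ M := by
  obtain ⟨A, rfl⟩ := hO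
  refine ⟨Aᴴ, ?_⟩
  ext s t
  rw [Matrix.conjTranspose_apply, tensorId_apply, tensorId_apply]
  simp only [eq_comm (a := t _)]
  split_ifs <;> simp

lemma weight_le_card {V : Operator Λ} {M : Finset Λ} (hV : SupportedOn V M) :
    weight V ≤ M.card := by
  classical
  refine Finset.card_le_card fun i hi => ?_
  by_contra hiM
  refine (Finset.mem_filter.mp hi).2 (hV.mono fun j hj => ?_)
  simp only [Finset.mem_compl, Finset.mem_singleton]
  rintro rfl
  exact hiM hj

lemma supportedOn_one (M : Finset Λ) : SupportedOn (1 : Operator Λ) M :=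
  supportedOn_of_commute fun _ _ _ _ => Commute.one_left _

end Support

/-! ### Slices of vectors and the Knill-Laflamme condition -/

section KnillLaflamme

variable {Λ : Type} [Fintype Λ] [DecidableEq Λ]

/-- The vector `(⟨m| ⊗ I) v` on the qubits outside `M`, for a basis configuration `m` of `M`. -/
def slice (M : Finset Λ) (m : Config {i // i ∈ M}) :
    (Config Λ → ℂ) →ₗ[ℂ] (Config {i // i ∉ M} → ℂ) :=
  LinearMap.funLeft ℂ ℂ (glue M m)

omit [Fintype Λ] in
lemma slice_apply (M : Finset Λ) (m : Config {i // i ∈ M}) (v : Config Λ → ℂ)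
    (s : Config {i // i ∉ M}) : slice M m v s = v (glue M m s) := rfl

lemma sum_glue {β : Type*} [AddCommMonoid β] (M : Finset Λ) (f : Config Λ → β) :
    ∑ s, f s = ∑ m : Config {i // i ∈ M}, ∑ r : Config {i // i ∉ M}, f (glue M m r) := by
  rw [← Fintype.sum_prod_type']
  exact (Fintype.sum_equiv (Equiv.piEquivPiSubtypeProd (fun i => i ∈ M) fun _ => Fin 2).symm
    _ _ fun _ => rfl).symm

omit [Fintype Λ] in
lemma glue_restrict (M : Finset Λ) (s : Config Λ) :
    glue M (fun i => s i) (fun i => s i) = s := by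
  funext i
  simp [glue]

lemma tensorId_glue (M : Finset Λ) (B : Operator {i // i ∈ M}) (m m' : Config {i // i ∈ M})
    (r r' : Config {i // i ∉ M}) :
    tensorId M B (glue M m r) (glue M m' r') = if r = r' then B m m' else 0 := by
  have h1 : (∀ i, i ∉ M → glue M m r i = glue M m' r' i) ↔ r = r' := by
    constructor
    · intro h
      funext ⟨i, hi⟩
      simpa [glue, hi] using h i hi
    · rintro rfl i hi
      simp [glue, hi]
  have h2 : ∀ (m : Config {i // i ∈ M}) (r : Config {i // i ∉ M}),
      (fun i : {i // i ∈ M} => glue M m r i) = m := by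
    intro m r
    funext ⟨i, hi⟩
    simp [glue, hi]
  rw [tensorId_apply, h2, h2]
  simp only [h1]

lemma slice_tensorId_mulVec (M : Finset Λ) (B : Operator {i // i ∈ M})
    (m : Config {i // i ∈ M}) (v : Config Λ → ℂ) :
    slice M m (tensorId M B *ᵥ v) = ∑ m', B m m' • slice M m' v := by
  funext r
  rw [slice_apply, Matrix.mulVec, dotProduct, sum_glue M]
  simp [tensorId_glue, slice_apply]

lemma star_dotProduct_eq_sum_slice (M : Finset Λ) (u v : Config Λ → ℂ) :
    star u ⬝ᵥ v = ∑ m, star (slice M m u) ⬝ᵥ slice M m v := by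
  rw [dotProduct, sum_glue M]
  rfl

lemma star_dotProduct_tensorId_mulVec (M : Finset Λ) (B : Operator {i // i ∈ M})
    (u v : Config Λ → ℂ) :
    star u ⬝ᵥ (tensorId M B *ᵥ v) =
      ∑ m, ∑ m', B m m' * (star (slice M m u) ⬝ᵥ slice M m' v) := by
  rw [star_dotProduct_eq_sum_slice M]
  simp [slice_tensorId_mulVec, dotProduct_sum]

omit [Fintype Λ] in
lemma partialTrace_vecMulVec (M : Finset Λ) (u v : Config Λ → ℂ) :
    partialTrace M (vecMulVec v (star u)) =
      ∑ m, vecMulVec (slice M m v) (star (slice M m u)) := by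
  ext s t
  simp [partialTrace, Matrix.sum_apply, vecMulVec_apply, slice_apply]

/-- The Knill-Laflamme condition: every operator on `M`, compressed to the code space `C`, is a
scalar. -/
def KnillLaflamme (C : Submodule ℂ (Config Λ → ℂ)) (M : Finset Λ) : Prop :=
  ∀ O : Operator Λ, SupportedOn O M → ∃ c : ℂ, ∀ u ∈ C, ∀ v ∈ C,
    star u ⬝ᵥ (O *ᵥ v) = c * (star u ⬝ᵥ v)

lemma KnillLaflamme.mono {C : Submodule ℂ (Config Λ → ℂ)} {M N : Finset Λ}
    (h : KnillLaflamme C N) (hMN : M ⊆ N) : KnillLaflamme C M :=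
  fun O hO => h O (hO.mono hMN)

lemma knillLaflamme_empty (C : Submodule ℂ (Config Λ → ℂ)) : KnillLaflamme C ∅ := by
  rintro _ ⟨B, rfl⟩
  refine ⟨∑ m, ∑ m', B m m', fun u _ v _ => ?_⟩
  rw [star_dotProduct_tensorId_mulVec, star_dotProduct_eq_sum_slice ∅]
  simp only [Fintype.sum_unique]

end KnillLaflamme

/-! ### Kraus operators -/

/-- Choi's theorem: a completely positive map has a Kraus decomposition. -/
lemma IsCompletelyPositive.exists_kraus {m n : Type} [Fintype m] [DecidableEq m] [Fintype n]
    {R : Matrix m m ℂ →ₗ[ℂ] Matrix n n ℂ} (hR : IsCompletelyPositive R) :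
    ∃ (k : ℕ) (K : Fin k → Matrix n m ℂ), ∀ Y, R Y = ∑ a, K a * Y * (K a)ᴴ := by
  classical
  let e := Fintype.equivFin m
  -- the unnormalised maximally entangled state
  let w : Fin (Fintype.card m) × m → ℂ := fun x => if e x.2 = x.1 then 1 else 0
  obtain ⟨k, v, hv⟩ := Matrix.posSemidef_iff_eq_sum_vecMulVec.mp
    (hR _ _ (Matrix.posSemidef_vecMulVec_self_star w))
  refine ⟨k, fun a => Matrix.of fun p i => v a (e i, p), fun Y => ?_⟩
  have hsingle : ∀ i j p q, R (Matrix.single i j 1) p q =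
      ∑ a, v a (e i, p) * star (v a (e j, q)) := by
    intro i j p q
    have := congrFun (congrFun hv (e i, p)) (e j, q)
    rw [Matrix.sum_apply] at this
    simp only [vecMulVec_apply, Pi.star_apply, Matrix.of_apply] at this
    rw [← this]
    have hw : Matrix.single i j 1 = Matrix.of fun i' j' => w (e i, i') * star (w (e j, j')) := by
      ext i' j'
      simp only [w, Matrix.of_apply, Matrix.single_apply, e.injective.eq_iff, eq_comm (a := i),
        eq_comm (a := j)]
      split_ifs <;> simp_all
    rw [hw]
  ext p q
  conv_lhs => rw [Matrix.matrix_eq_sum_single Y]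
  simp only [map_sum, Matrix.sum_apply, Matrix.mul_apply, Matrix.conjTranspose_apply,
    Matrix.of_apply, Finset.sum_mul]
  have h1 : ∀ i j, R (Matrix.single i j (Y i j)) p q =
      ∑ a, v a (e i, p) * Y i j * star (v a (e j, q)) := by
    intro i j
    have : Matrix.single i j (Y i j) = Y i j • Matrix.single i j (1 : ℂ) := by simp
    rw [this, map_smul, Matrix.smul_apply, hsingle, smul_eq_mul, Finset.mul_sum]
    exact Finset.sum_congr rfl fun a _ => by ring
  simp only [h1]
  rw [Finset.sum_comm]
  conv_rhs => rw [Finset.sum_comm]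
  rw [Finset.sum_congr rfl fun i _ => Finset.sum_comm, Finset.sum_comm]

/-! ### Correctable sets satisfy the Knill-Laflamme condition -/

section Correctable

variable {Λ : Type} [Fintype Λ] [DecidableEq Λ]

lemma trace_vecMulVec_star {m : Type*} [Fintype m] (u v : m → ℂ) :
    (vecMulVec v (star u)).trace = star u ⬝ᵥ v := by
  rw [Matrix.trace_vecMulVec, dotProduct_comm]

lemma mul_vecMulVec_star_mul {m n : Type*} [Fintype m] (K : Matrix n m ℂ) (u v : m → ℂ) :
    K * vecMulVec v (star u) * Kᴴ = vecMulVec (K *ᵥ v) (star (K *ᵥ u)) := by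
  rw [Matrix.mul_vecMulVec, Matrix.vecMulVec_mul, Matrix.star_mulVec]

/-- A recovery map restores the operators `|v⟩⟨v|` with `v` in the code space; by polarization it
restores all `|v⟩⟨u|`. -/
lemma recovery_vecMulVec {C : Submodule ℂ (Config Λ → ℂ)} {M : Finset Λ}
    {R : Operator {i // i ∉ M} →ₗ[ℂ] Operator Λ}
    (hR : ∀ ρ, IsCodeState C ρ → R (partialTrace M ρ) = ρ) {u v : Config Λ → ℂ}
    (hu : u ∈ C) (hv : v ∈ C) :
    R (partialTrace M (vecMulVec v (star u))) = vecMulVec v (star u) := by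
  have hdiag : ∀ x ∈ C, R (partialTrace M (vecMulVec x (star x))) = vecMulVec x (star x) := by
    intro x hx
    by_cases hx0 : x = 0
    · subst hx0
      have : partialTrace M (0 : Operator Λ) = 0 := by ext; simp [partialTrace]
      simp [this]
    have hne : star x ⬝ᵥ x ≠ 0 := fun h => hx0 (dotProduct_star_self_eq_zero.mp h)
    have hpos : 0 ≤ (star x ⬝ᵥ x)⁻¹ := by
      have := dotProduct_star_self_nonneg x
      exact inv_nonneg.mpr this
    have h := hR ((star x ⬝ᵥ x)⁻¹ • vecMulVec x (star x))
      ⟨(Matrix.posSemidef_vecMulVec_self_star x).smul hpos, by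
        rw [Matrix.trace_smul, trace_vecMulVec_star, smul_eq_mul, inv_mul_cancel₀ hne], fun y => by
        rw [Matrix.smul_mulVec, Matrix.vecMulVec_mulVec]
        exact C.smul_mem _ (by simpa using C.smul_mem _ hx)⟩
    have h2 : partialTrace M ((star x ⬝ᵥ x)⁻¹ • vecMulVec x (star x)) =
        (star x ⬝ᵥ x)⁻¹ • partialTrace M (vecMulVec x (star x)) := by
      ext; simp [partialTrace, Finset.mul_sum]
    rw [h2, map_smul] at h
    exact smul_right_injective _ (inv_ne_zero hne) h
  have hadd : ∀ X Y : Operator Λ, partialTrace M (X + Y) = partialTrace M X + partialTrace M Y := by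
    intro X Y; ext; simp [partialTrace, Finset.sum_add_distrib]
  have hsmul : ∀ (c : ℂ) (X : Operator Λ), partialTrace M (c • X) = c • partialTrace M X := by
    intro c X; ext; simp [partialTrace, Finset.mul_sum]
  have h1 := hdiag (v + u) (C.add_mem hv hu)
  have h2 := hdiag (v + Complex.I • u) (C.add_mem hv (C.smul_mem _ hu))
  have hI : star Complex.I = -Complex.I := Complex.conj_I
  simp only [star_add, star_smul, add_vecMulVec, vecMulVec_add, smul_vecMulVec, vecMulVec_smul,
    hadd, hsmul, map_add, map_smul, hdiag v hv, hdiag u hu, hI] at h1 h2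
  set a := R (partialTrace M (vecMulVec v (star u)))
  set b := R (partialTrace M (vecMulVec u (star v)))
  set a' := vecMulVec v (star u)
  set b' := vecMulVec u (star v)
  have h3 : (a - a') + (b - b') = 0 := by
    linear_combination (norm := module) h1
  have h4 : (a - a') - (b - b') = 0 := by
    have : Complex.I • ((a - a') - (b - b')) = 0 := by
      have := h2
      simp only [smul_sub]
      linear_combination (norm := module) -h2
    exact (smul_eq_zero.mp this).resolve_left Complex.I_ne_zero
  have h5 : (2 : ℂ) • (a - a') = 0 := by
    rw [two_smul]
    linear_combination (norm := module) h3 + h4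
  exact sub_eq_zero.mp ((smul_eq_zero.mp h5).resolve_left two_ne_zero)

/-- If the erasure of `M` can be reversed, then `M` satisfies the Knill-Laflamme condition: each
Kraus operator of "erase `M`, then recover" acts as a scalar on the code space. -/
lemma IsCorrectable.knillLaflamme {C : Submodule ℂ (Config Λ → ℂ)} {M : Finset Λ}
    (h : IsCorrectable C M) : KnillLaflamme C M := by
  obtain ⟨R, hCP, hTP, hR⟩ := h
  obtain ⟨k, K, hK⟩ := hCP.exists_kraus
  let S : Fin k → Config {i // i ∈ M} → (Config Λ → ℂ) → (Config Λ → ℂ) :=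
    fun a m v => K a *ᵥ slice M m v
  have hS : ∀ u ∈ C, ∀ v ∈ C,
      ∑ m, ∑ a, vecMulVec (S a m v) (star (S a m u)) = vecMulVec v (star u) := by
    intro u hu v hv
    rw [← recovery_vecMulVec hR hu hv, partialTrace_vecMulVec, map_sum]
    refine Finset.sum_congr rfl fun m _ => ?_
    rw [hK]
    exact Finset.sum_congr rfl fun a _ => (mul_vecMulVec_star_mul ..).symm
  have hS' : ∀ u ∈ C, ∀ v ∈ C, ∀ x, ∑ m, ∑ a, (star (S a m u) ⬝ᵥ x) • S a m v =
      (star u ⬝ᵥ x) • v := by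
    intro u hu v hv x
    have := congrArg (fun X => X *ᵥ x) (hS u hu v hv)
    simpa [Matrix.sum_mulVec, Matrix.vecMulVec_mulVec] using this
  have hK' : ∀ x y : Config {i // i ∉ M} → ℂ,
      ∑ a, star (K a *ᵥ x) ⬝ᵥ (K a *ᵥ y) = star x ⬝ᵥ y := by
    intro x y
    rw [← trace_vecMulVec_star, ← hTP, hK, Matrix.trace_sum]
    exact Finset.sum_congr rfl fun a _ => by rw [mul_vecMulVec_star_mul, trace_vecMulVec_star]
  -- the scalars are read off from a nonzero vector of the code space
  have hscalar : ∃ c : Fin k → Config {i // i ∈ M} → ℂ, ∀ v ∈ C, ∀ a m, S a m v = c a m • v := by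
    by_cases hC : ∃ x ∈ C, x ≠ 0
    swap
    · push Not at hC
      exact ⟨0, fun v hv a m => by simp [S, hC v hv]⟩
    obtain ⟨x, hx, hx0⟩ := hC
    have hne : star x ⬝ᵥ x ≠ 0 := fun h => hx0 (dotProduct_star_self_eq_zero.mp h)
    set n := star x ⬝ᵥ x with hn
    have hnstar : star n = n := by rw [hn, ← star_dotProduct]
    let c : Fin k → Config {i // i ∈ M} → ℂ := fun a m => (star x ⬝ᵥ S a m x) / n
    have hcstar : ∀ a m, star (c a m) = (star (S a m x) ⬝ᵥ x) / n := by
      intro a m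
      simp only [c]
      rw [star_div₀, hnstar, ← star_dotProduct]
    have h1 : ∀ v ∈ C, ∑ m, ∑ a, star (c a m) • S a m v = v := by
      intro v hv
      have := congrArg (fun y => n⁻¹ • y) (hS' x hx v hv x)
      simp only [Finset.smul_sum, smul_smul, ← hn, inv_mul_cancel₀ hne, one_smul] at this
      conv_rhs => rw [← this]
      exact Finset.sum_congr rfl fun m _ => Finset.sum_congr rfl fun a _ => by
        rw [hcstar, div_eq_inv_mul]
    have h2 : ∑ m, ∑ a, star (c a m) * c a m = 1 := by
      have := congrArg (fun y => n⁻¹ * (star x ⬝ᵥ y)) (h1 x hx)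
      simp only [dotProduct_sum, dotProduct_smul, smul_eq_mul, Finset.mul_sum,
        ← hn, inv_mul_cancel₀ hne] at this
      rw [← this]
      exact Finset.sum_congr rfl fun m _ => Finset.sum_congr rfl fun a _ => by
        simp only [c]; ring
    refine ⟨c, fun v hv a m => ?_⟩
    have h3 : ∑ m, ∑ a, star (S a m v) ⬝ᵥ S a m v = star v ⬝ᵥ v := by
      rw [← trace_vecMulVec_star, ← hS v hv v hv]
      simp only [Matrix.trace_sum, trace_vecMulVec_star]
    have h4 : ∑ m, ∑ a, star (c a m) * (star v ⬝ᵥ S a m v) = star v ⬝ᵥ v := by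
      conv_rhs => rw [← h1 v hv]
      simp only [dotProduct_sum, dotProduct_smul, smul_eq_mul]
      rw [h1 v hv]
    have h5 : ∑ m, ∑ a, c a m * (star (S a m v) ⬝ᵥ v) = star v ⬝ᵥ v := by
      have := congrArg star h4
      simp only [star_sum, star_mul', star_star, ← star_dotProduct] at this
      exact this
    have h6 : ∑ m, ∑ a, star (S a m v - c a m • v) ⬝ᵥ (S a m v - c a m • v) = 0 := by
      have : ∀ a m, star (S a m v - c a m • v) ⬝ᵥ (S a m v - c a m • v) =
          star (S a m v) ⬝ᵥ S a m v - c a m * (star (S a m v) ⬝ᵥ v) -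
            star (c a m) * (star v ⬝ᵥ S a m v) + star (c a m) * c a m * (star v ⬝ᵥ v) := by
        intro a m
        rw [star_sub, star_smul, sub_dotProduct, dotProduct_sub, dotProduct_sub]
        simp only [smul_dotProduct, dotProduct_smul, smul_eq_mul]
        ring
      simp only [this, Finset.sum_add_distrib, Finset.sum_sub_distrib, ← Finset.sum_mul, h2, h3,
        h4, h5]
      ring
    have h7 := (Finset.sum_eq_zero_iff_of_nonneg fun m _ =>
      Finset.sum_nonneg fun a _ => dotProduct_star_self_nonneg _).mp h6 m (Finset.mem_univ _)
    have h8 := (Finset.sum_eq_zero_iff_of_nonneg fun a _ =>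
      dotProduct_star_self_nonneg _).mp h7 a (Finset.mem_univ _)
    exact sub_eq_zero.mp (dotProduct_star_self_eq_zero.mp h8)
  obtain ⟨c, hc⟩ := hscalar
  rintro _ ⟨B, rfl⟩
  refine ⟨∑ m, ∑ m', B m m' * ∑ a, star (c a m) * c a m', fun u hu v hv => ?_⟩
  rw [star_dotProduct_tensorId_mulVec, Finset.sum_mul]
  refine Finset.sum_congr rfl fun m _ => ?_
  rw [Finset.sum_mul]
  refine Finset.sum_congr rfl fun m' _ => ?_
  rw [← hK', mul_assoc, Finset.sum_mul]
  congr 1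
  refine Finset.sum_congr rfl fun a _ => ?_
  have e1 : K a *ᵥ slice M m u = c a m • u := hc u hu a m
  have e2 : K a *ᵥ slice M m' v = c a m' • v := hc v hv a m'
  rw [e1, e2, star_smul, smul_dotProduct, dotProduct_smul, smul_eq_mul, smul_eq_mul, mul_assoc]

lemma ext_of_star_dotProduct {n : Type*} [Fintype n] [DecidableEq n] {A B : Matrix n n ℂ}
    (h : ∀ u v : n → ℂ, star u ⬝ᵥ (A *ᵥ v) = star u ⬝ᵥ (B *ᵥ v)) : A = B := by
  ext i j
  simpa using h (Pi.single i 1) (Pi.single j 1)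

lemma exists_projection {n : Type*} [Fintype n] [DecidableEq n] (C : Submodule ℂ (n → ℂ)) :
    ∃ P : Matrix n n ℂ, Pᴴ = P ∧ (∀ v, P *ᵥ v ∈ C) ∧ ∀ v ∈ C, P *ᵥ v = v := by
  let C' : Submodule ℂ (EuclideanSpace ℂ n) :=
    C.comap (WithLp.linearEquiv 2 ℂ (n → ℂ)).toLinearMap
  let T : EuclideanSpace ℂ n →ₗ[ℂ] EuclideanSpace ℂ n := C'.starProjection.toLinearMap
  have hT : Matrix.toEuclideanLin (Matrix.toEuclideanLin.symm T) = T :=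
    LinearEquiv.apply_symm_apply _ _
  have hP : ∀ v, (Matrix.toEuclideanLin.symm T) *ᵥ v = (T (WithLp.toLp 2 v)).ofLp := by
    intro v
    conv_rhs => rw [← hT]
    rfl
  refine ⟨Matrix.toEuclideanLin.symm T, ?_, fun v => ?_, fun v hv => ?_⟩
  · apply Matrix.isSymmetric_toEuclideanLin_iff.mp
    rw [hT]
    exact C'.starProjection_isSymmetric
  · rw [hP]
    exact C'.starProjection_apply_mem _
  · rw [hP]
    have : WithLp.toLp 2 v ∈ C' := hv
    exact congrArg WithLp.ofLp (Submodule.starProjection_eq_self_iff.mpr this)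

/-- If the whole lattice satisfies the Knill-Laflamme condition, then the code has at most one
state, so that every set is correctable: discard the input and prepare that state. -/
lemma isCorrectable_of_knillLaflamme_univ {C : Submodule ℂ (Config Λ → ℂ)}
    (h : KnillLaflamme C Finset.univ) (M : Finset Λ) : IsCorrectable C M := by
  have huniq : ∀ ρ σ, IsCodeState C ρ → IsCodeState C σ → ρ = σ := by
    obtain ⟨P, hPstar, hPC, hP⟩ := exists_projection C
    have hPρ : ∀ ρ, IsCodeState C ρ → P * ρ = ρ ∧ ρ * P = ρ := by
      intro ρ hρ
      have h1 : P * ρ = ρ := ext_of_star_dotProduct fun u v => by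
        rw [← Matrix.mulVec_mulVec, hP _ (hρ.2.2 v)]
      refine ⟨h1, ?_⟩
      have := congrArg Matrix.conjTranspose h1
      rwa [Matrix.conjTranspose_mul, hPstar, hρ.1.1.eq] at this
    have hPO : ∀ O : Operator Λ, ∃ c : ℂ, P * O * P = c • P := by
      intro O
      obtain ⟨c, hc⟩ := h O (supportedOn_of_commute fun i hi => absurd (Finset.mem_univ i) hi)
      refine ⟨c, ext_of_star_dotProduct fun u v => ?_⟩
      have hmove : ∀ x, star u ⬝ᵥ (P *ᵥ x) = star (P *ᵥ u) ⬝ᵥ x := by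
        intro x
        rw [Matrix.star_mulVec, hPstar, Matrix.dotProduct_mulVec]
      have hPP : P *ᵥ v = P *ᵥ (P *ᵥ v) := (hP _ (hPC v)).symm
      rw [← Matrix.mulVec_mulVec, ← Matrix.mulVec_mulVec, hmove, hc _ (hPC u) _ (hPC v),
        Matrix.smul_mulVec, dotProduct_smul, smul_eq_mul, hPP, hmove, ← hPP]
    have htr : ∀ ρ, IsCodeState C ρ → ∀ (O : Operator Λ) (c : ℂ), P * O * P = c • P →
        (ρ * O).trace = c := by
      intro ρ hρ O c hc
      calc (ρ * O).trace = (P * ρ * (P * O)).trace := by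
            rw [(hPρ ρ hρ).1, ← Matrix.mul_assoc, (hPρ ρ hρ).2]
        _ = (ρ * (P * O * P)).trace := by
            rw [Matrix.mul_assoc, Matrix.trace_mul_comm, Matrix.mul_assoc]
        _ = c := by
            rw [hc, Matrix.mul_smul, (hPρ ρ hρ).2, Matrix.trace_smul, hρ.2.1, smul_eq_mul, mul_one]
    intro ρ σ hρ hσ
    refine Matrix.ext_iff_trace_mul_right.mpr fun O => ?_
    obtain ⟨c, hc⟩ := hPO O
    rw [htr ρ hρ O c hc, htr σ hσ O c hc]
  obtain ⟨τ, hτ, hτtr, hτuniq⟩ : ∃ τ : Operator Λ, τ.PosSemidef ∧ τ.trace = 1 ∧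
      ∀ ρ, IsCodeState C ρ → ρ = τ := by
    by_cases hex : ∃ ρ, IsCodeState C ρ
    · obtain ⟨ρ, hρ⟩ := hex
      exact ⟨ρ, hρ.1, hρ.2.1, fun σ hσ => huniq σ ρ hσ hρ⟩
    · refine ⟨vecMulVec (Pi.single 0 1) (star (Pi.single 0 1)),
        Matrix.posSemidef_vecMulVec_self_star _, ?_, fun ρ hρ => absurd ⟨ρ, hρ⟩ hex⟩
      rw [trace_vecMulVec_star]
      simp
  refine ⟨(Matrix.traceLinearMap _ ℂ ℂ).smulRight τ, fun k X hX => ?_, fun X => ?_, fun ρ hρ => ?_⟩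
  · have hsum : (∑ i, X.submatrix (fun a : Fin k => (a, i)) (fun a => (a, i))).PosSemidef :=
      Matrix.posSemidef_sum _ fun i _ => hX.submatrix _
    have heq : (Matrix.of fun a b : Fin k × Config Λ =>
        ((Matrix.traceLinearMap _ ℂ ℂ).smulRight τ)
          (Matrix.of fun i j => X (a.1, i) (b.1, j)) a.2 b.2) =
        Matrix.kroneckerMap (· * ·)
          (∑ i, X.submatrix (fun a : Fin k => (a, i)) (fun a => (a, i))) τ := by
      ext a b
      simp [Matrix.trace, Matrix.sum_apply]
    rw [heq]
    exact hsum.kronecker hτ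
  · simp [hτtr]
  · have htrace : (partialTrace M ρ).trace = 1 := by
      rw [← hρ.2.1, Matrix.trace, Matrix.trace, sum_glue M, Finset.sum_comm]
      rfl
    rw [hτuniq ρ hρ] at htrace ⊢
    simp [htrace]

end Correctable

/-! ### Matrix units on a set of qubits -/

section MatrixUnits

variable {Λ : Type} [Fintype Λ] [DecidableEq Λ]

/-- The operator `|m⟩⟨m'| ⊗ I`, with the matrix unit acting on the qubits in `M`. -/
def unitOn (M : Finset Λ) (m m' : Config {i // i ∈ M}) : Operator Λ :=
  tensorId M (Matrix.single m m' 1)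

lemma supportedOn_unitOn (M : Finset Λ) (m m' : Config {i // i ∈ M}) :
    SupportedOn (unitOn M m m') M := ⟨_, rfl⟩

lemma eq_of_slice_mulVec {M : Finset Λ} {A B : Operator Λ}
    (h : ∀ m v, slice M m (A *ᵥ v) = slice M m (B *ᵥ v)) : A = B := by
  refine ext_of_star_dotProduct fun u v => ?_
  rw [star_dotProduct_eq_sum_slice M, star_dotProduct_eq_sum_slice M u]
  simp only [h]

lemma slice_unitOn_mulVec (M : Finset Λ) (k m m' : Config {i // i ∈ M}) (v : Config Λ → ℂ) :
    slice M k (unitOn M m m' *ᵥ v) = if m = k then slice M m' v else 0 := by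
  rw [unitOn, slice_tensorId_mulVec]
  split_ifs with h
  · subst h
    simp [Matrix.single_apply]
  · simp [h]

lemma unitOn_mul_unitOn (M : Finset Λ) (m m' n n' : Config {i // i ∈ M}) :
    unitOn M m m' * unitOn M n n' = if n = m' then unitOn M m n' else 0 := by
  refine eq_of_slice_mulVec (M := M) fun k v => ?_
  rw [← Matrix.mulVec_mulVec, slice_unitOn_mulVec, slice_unitOn_mulVec]
  by_cases h : n = m'
  · rw [if_pos h, if_pos h, slice_unitOn_mulVec]
  · rw [if_neg h, if_neg h, Matrix.zero_mulVec, map_zero, ite_self]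

lemma sum_unitOn (M : Finset Λ) : ∑ m, unitOn M m m = 1 := by
  refine eq_of_slice_mulVec (M := M) fun k v => ?_
  simp [Matrix.sum_mulVec, slice_unitOn_mulVec]

lemma tensorId_eq_sum_unitOn (M : Finset Λ) (B : Operator {i // i ∈ M}) :
    tensorId M B = ∑ m, ∑ m', B m m' • unitOn M m m' := by
  refine eq_of_slice_mulVec (M := M) fun k v => ?_
  simp only [slice_tensorId_mulVec, Matrix.sum_mulVec, Matrix.smul_mulVec, map_sum, map_smul,
    slice_unitOn_mulVec]
  conv_rhs => rw [Finset.sum_eq_single k (fun m _ hm => by simp [hm]) (by simp)]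
  simp

/-- The operator `I ⊗ ⟨m|O|m'⟩`, where the matrix element is taken with respect to the qubits
in `M`. -/
def blockOn (M : Finset Λ) (m m' : Config {i // i ∈ M}) (O : Operator Λ) : Operator Λ :=
  ∑ b, unitOn M b m * O * unitOn M m' b

lemma commute_blockOn {M : Finset Λ} (m m' : Config {i // i ∈ M}) (O : Operator Λ)
    {P : Operator Λ} (hP : SupportedOn P M) : Commute (blockOn M m m' O) P := by
  obtain ⟨B, rfl⟩ := hP
  rw [tensorId_eq_sum_unitOn]
  refine Commute.sum_right _ _ _ fun n _ => Commute.sum_right _ _ _ fun n' _ =>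
    Commute.smul_right ?_ _
  rw [Commute, SemiconjBy, blockOn, Finset.sum_mul, Finset.mul_sum]
  rw [Finset.sum_eq_single n, Finset.sum_eq_single n']
  · rw [Matrix.mul_assoc, unitOn_mul_unitOn, if_pos rfl, ← Matrix.mul_assoc, ← Matrix.mul_assoc,
      unitOn_mul_unitOn, if_pos rfl]
  · intro b _ hb
    rw [← Matrix.mul_assoc, ← Matrix.mul_assoc, unitOn_mul_unitOn, if_neg hb, Matrix.zero_mul,
      Matrix.zero_mul]
  · simp
  · intro b _ hb
    rw [Matrix.mul_assoc, unitOn_mul_unitOn, if_neg hb.symm, Matrix.mul_zero]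
  · simp

lemma supportedOn_blockOn {M N : Finset Λ} (m m' : Config {i // i ∈ M}) {O : Operator Λ}
    (hO : SupportedOn O N) : SupportedOn (blockOn M m m' O) (N \ M) := by
  refine supportedOn_of_commute fun i hi P hP => ?_
  by_cases hiM : i ∈ M
  · exact commute_blockOn m m' O (hP.mono (by simpa using hiM))
  · have hiN : i ∉ N := fun hiN => hi (Finset.mem_sdiff.mpr ⟨hiN, hiM⟩)
    refine Commute.sum_left _ _ _ fun b _ => ?_
    refine ((?_ : Commute _ _).mul_left ?_).mul_left ?_
    · exact (supportedOn_unitOn M b m).commute hP (by simpa using hiM)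
    · exact hO.commute hP (by simpa using hiN)
    · exact (supportedOn_unitOn M m' b).commute hP (by simpa using hiM)

lemma eq_sum_unitOn_mul_blockOn (M : Finset Λ) (O : Operator Λ) :
    O = ∑ m, ∑ m', unitOn M m m' * blockOn M m m' O := by
  have h : ∀ m m', unitOn M m m' * blockOn M m m' O = unitOn M m m * O * unitOn M m' m' := by
    intro m m'
    rw [blockOn, Finset.mul_sum, Finset.sum_eq_single m']
    · rw [← Matrix.mul_assoc, ← Matrix.mul_assoc, unitOn_mul_unitOn, if_pos rfl]
    · intro b _ hb
      rw [← Matrix.mul_assoc, ← Matrix.mul_assoc, unitOn_mul_unitOn, if_neg hb, Matrix.zero_mul,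
        Matrix.zero_mul]
    · simp
  simp only [h, ← Finset.mul_sum, ← Finset.sum_mul, sum_unitOn, one_mul, mul_one]

end MatrixUnits

/-! ### Cleaning logical operators off a correctable set -/

section Cleaning

variable {Λ : Type} [Fintype Λ] [DecidableEq Λ]

lemma exists_comp_eq_of_ker_le {V W U : Type*} [AddCommGroup V] [Module ℂ V] [AddCommGroup W]
    [Module ℂ W] [AddCommGroup U] [Module ℂ U] {F : V →ₗ[ℂ] W} {G : V →ₗ[ℂ] U}
    (h : LinearMap.ker F ≤ LinearMap.ker G) : ∃ Y : W →ₗ[ℂ] U, ∀ x, Y (F x) = G x := by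
  obtain ⟨Y, hY⟩ := LinearMap.exists_extend
    ((LinearMap.ker F).liftQ G h ∘ₗ F.quotKerEquivRange.symm.toLinearMap)
  refine ⟨Y, fun x => ?_⟩
  have := LinearMap.congr_fun hY ⟨F x, LinearMap.mem_range_self F x⟩
  simp only [LinearMap.comp_apply, Submodule.subtype_apply] at this
  rw [this]
  have hx : F.quotKerEquivRange.symm ⟨F x, LinearMap.mem_range_self F x⟩ =
      Submodule.Quotient.mk x := F.quotKerEquivRange_symm_apply_image x _
  simp [hx]

/-- An operator `Y` on the qubits outside `M`, extended by the identity on `M`, acts as `Y` on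
all slices. -/
lemma exists_supportedOn_compl (M : Finset Λ) (Y : Operator {i // i ∉ M}) :
    ∃ Z : Operator Λ, SupportedOn Z Mᶜ ∧
      ∀ m v, slice M m (Z *ᵥ v) = Y *ᵥ slice M m v := by
  refine ⟨_, ⟨Matrix.of fun x y => Y (fun i => x ⟨i, Finset.mem_compl.mpr i.2⟩)
    (fun i => y ⟨i, Finset.mem_compl.mpr i.2⟩), rfl⟩, fun m v => ?_⟩
  have hZ : ∀ (m m' : Config {i // i ∈ M}) (r r' : Config {i // i ∉ M}),
      tensorId Mᶜ (Matrix.of fun x y => Y (fun i => x ⟨i, Finset.mem_compl.mpr i.2⟩)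
        (fun i => y ⟨i, Finset.mem_compl.mpr i.2⟩)) (glue M m r) (glue M m' r') =
      if m = m' then Y r r' else 0 := by
    intro m m' r r'
    have h1 : (∀ i, i ∉ Mᶜ → glue M m r i = glue M m' r' i) ↔ m = m' := by
      constructor
      · intro h
        funext ⟨i, hi⟩
        simpa [glue, hi] using h i (by simpa using hi)
      · rintro rfl i hi
        have : i ∈ M := by simpa using hi
        simp [glue, this]
    have h2 : ∀ (m : Config {i // i ∈ M}) (r : Config {i // i ∉ M}),
        (fun i : {i // i ∉ M} => glue M m r i) = r := by
      intro m r
      funext ⟨i, hi⟩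
      simp [glue, hi]
    rw [tensorId_apply, Matrix.of_apply, h2, h2]
    simp only [h1]
  funext r
  rw [slice_apply, Matrix.mulVec, dotProduct, sum_glue M]
  simp [hZ, slice_apply, Matrix.mulVec, dotProduct]

/-- Cleaning lemma: if `M` satisfies the Knill-Laflamme condition, then every logical operator is
equivalent to an operator on the complement of `M`. -/
lemma KnillLaflamme.exists_equivalent {C : Submodule ℂ (Config Λ → ℂ)} {M : Finset Λ}
    (h : KnillLaflamme C M) {X : Operator Λ} (hX : IsLogical C X) :
    ∃ Y : Operator Λ, SupportedOn Y Mᶜ ∧ Equivalent C X Y := by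
  have hslice : ∀ m m', ∃ c : ℂ, ∀ u ∈ C, ∀ v ∈ C,
      star (slice M m u) ⬝ᵥ slice M m' v = c * (star u ⬝ᵥ v) := by
    intro m m'
    obtain ⟨c, hc⟩ := h _ (supportedOn_unitOn M m m')
    refine ⟨c, fun u hu v hv => ?_⟩
    rw [← hc u hu v hv, star_dotProduct_eq_sum_slice M]
    simp only [slice_unitOn_mulVec]
    rw [Finset.sum_eq_single m (fun k _ hk => by simp [hk.symm]) (by simp), if_pos rfl]
  choose c hc using hslice
  -- the operator `Y` outside `M` must send `⟨m|v` to `⟨m|Xv` for all `v` in the code space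
  let F : (Config {i // i ∈ M} → C) →ₗ[ℂ] (Config {i // i ∉ M} → ℂ) :=
    ∑ m, slice M m ∘ₗ C.subtype ∘ₗ LinearMap.proj m
  let G : (Config {i // i ∈ M} → C) →ₗ[ℂ] (Config {i // i ∉ M} → ℂ) :=
    ∑ m, slice M m ∘ₗ X.mulVecLin ∘ₗ C.subtype ∘ₗ LinearMap.proj m
  have hF : ∀ ψ, F ψ = ∑ m, slice M m (ψ m : Config Λ → ℂ) := by
    intro ψ; simp [F, LinearMap.sum_apply]
  have hG : ∀ ψ, G ψ = ∑ m, slice M m (X *ᵥ (ψ m : Config Λ → ℂ)) := by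
    intro ψ; simp [G, LinearMap.sum_apply]
  have hker : LinearMap.ker F ≤ LinearMap.ker G := by
    intro ψ hψ
    rw [LinearMap.mem_ker, hF] at hψ
    rw [LinearMap.mem_ker]
    have h1 : ∀ m, ∑ m', c m m' • (ψ m' : Config Λ → ℂ) = 0 := by
      intro m
      have hmem : ∑ m', c m m' • (ψ m' : Config Λ → ℂ) ∈ C :=
        C.sum_mem fun m' _ => C.smul_mem _ (ψ m').2
      refine dotProduct_star_self_eq_zero.mp ?_
      have := congrArg
        (fun y => star (slice M m (∑ m', c m m' • (ψ m' : Config Λ → ℂ))) ⬝ᵥ y) hψ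
      simp only [dotProduct_sum, dotProduct_zero] at this
      rw [← this, dotProduct_sum]
      refine Finset.sum_congr rfl fun m' _ => ?_
      rw [hc m m' _ hmem _ (ψ m').2, dotProduct_smul, smul_eq_mul]
    refine dotProduct_star_self_eq_zero.mp ?_
    rw [hG, star_sum, sum_dotProduct]
    refine Finset.sum_eq_zero fun m _ => ?_
    rw [dotProduct_sum]
    calc ∑ m', star (slice M m (X *ᵥ (ψ m : Config Λ → ℂ))) ⬝ᵥ slice M m' (X *ᵥ (ψ m').1)
        = star (X *ᵥ (ψ m).1) ⬝ᵥ (X *ᵥ ∑ m', c m m' • (ψ m' : Config Λ → ℂ)) := by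
          rw [Matrix.mulVec_sum, dotProduct_sum]
          refine Finset.sum_congr rfl fun m' _ => ?_
          rw [hc m m' _ (hX _ (ψ m).2) _ (hX _ (ψ m').2), Matrix.mulVec_smul, dotProduct_smul,
            smul_eq_mul]
      _ = 0 := by rw [h1 m, Matrix.mulVec_zero, dotProduct_zero]
  obtain ⟨Y, hY⟩ := exists_comp_eq_of_ker_le hker
  obtain ⟨Z, hZ, hZY⟩ := exists_supportedOn_compl M (LinearMap.toMatrix' Y)
  refine ⟨Z, hZ, fun v hv => ?_⟩
  have hslices : ∀ m, slice M m (Z *ᵥ v) = slice M m (X *ᵥ v) := by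
    intro m
    rw [hZY, LinearMap.toMatrix'_mulVec]
    have := hY (Pi.single m ⟨v, hv⟩)
    rw [hF, hG, Finset.sum_eq_single m, Finset.sum_eq_single m] at this
    · simpa using this
    · intro b _ hb; simp [hb]
    · simp
    · intro b _ hb; simp [hb]
    · simp
  funext s
  have := congrFun (hslices fun i => s i) fun i => s i
  rw [slice_apply, slice_apply, glue_restrict] at this
  exact this.symm

end Cleaning

/-! ### Growing and joining correctable sets -/

section CommutingProjectors

variable {Λ : Type} [Fintype Λ] [DecidableEq Λ]

/-- The product of a finite set of commuting projectors. -/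
lemma exists_prod_projectors {n : Type*} [Fintype n] [DecidableEq n] (T : Finset (Matrix n n ℂ))
    (hproj : ∀ P ∈ T, IsStarProjection P) (hcomm : ∀ P ∈ T, ∀ Q ∈ T, Commute P Q) :
    ∃ Q : Matrix n n ℂ, Qᴴ = Q ∧ (∀ v, (∀ P ∈ T, P *ᵥ v = v) → Q *ᵥ v = v) ∧
      (∀ P ∈ T, P * Q = Q) ∧ ∀ A, (∀ P ∈ T, Commute P A) → Commute Q A := by
  induction T using Finset.induction_on with
  | empty => exact ⟨1, by simp, by simp, by simp, fun A _ => Commute.one_left A⟩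
  | insert P T _ ih =>
    obtain ⟨Q, hQ1, hQ2, hQ3, hQ4⟩ := ih (fun P hP => hproj P (Finset.mem_insert_of_mem hP))
      fun P hP Q hQ => hcomm P (Finset.mem_insert_of_mem hP) Q (Finset.mem_insert_of_mem hQ)
    have hP := hproj P (Finset.mem_insert_self _ _)
    have hPP : ∀ P' ∈ T, Commute P' P := fun P' hP' =>
      hcomm P' (Finset.mem_insert_of_mem hP') P (Finset.mem_insert_self _ _)
    have hQP : Commute Q P := hQ4 P hPP
    refine ⟨P * Q, ?_, fun v hv => ?_, fun P' hP' => ?_, fun A hA => ?_⟩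
    · have hPstar : Pᴴ = P := hP.isSelfAdjoint
      rw [Matrix.conjTranspose_mul, hQ1, hPstar, hQP.eq]
    · rw [← Matrix.mulVec_mulVec, hQ2 v fun P' hP' => hv P' (Finset.mem_insert_of_mem hP'),
        hv P (Finset.mem_insert_self _ _)]
    · rcases Finset.mem_insert.mp hP' with rfl | hP'
      · rw [← Matrix.mul_assoc, hP.isIdempotentElem.eq]
      · rw [← Matrix.mul_assoc, (hPP P' hP').eq, Matrix.mul_assoc, hQ3 P' hP']
    · exact (hA P (Finset.mem_insert_self _ _)).mul_left
        (hQ4 A fun P' hP' => hA P' (Finset.mem_insert_of_mem hP'))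

lemma star_mulVec_dotProduct {n : Type*} [Fintype n] (A : Matrix n n ℂ) (u v : n → ℂ) :
    star (A *ᵥ u) ⬝ᵥ v = star u ⬝ᵥ (Aᴴ *ᵥ v) := by
  rw [Matrix.star_mulVec, Matrix.dotProduct_mulVec]

/-- Decoupling: if every projector commutes with one of the operators `A` and `B`, then a scalar
compression of `A` factors out of the compression of `A * B`. -/
lemma star_dotProduct_mulVec_mulVec {C : Submodule ℂ (Config Λ → ℂ)} {Ps : Finset (Operator Λ)}
    (hproj : ∀ P ∈ Ps, IsStarProjection P) (hcomm : ∀ P ∈ Ps, ∀ Q ∈ Ps, Commute P Q)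
    (hC : ∀ v, v ∈ C ↔ ∀ P ∈ Ps, P *ᵥ v = v) {A B : Operator Λ}
    (hAB : ∀ P ∈ Ps, Commute P A ∨ Commute P B) {c : ℂ}
    (hc : ∀ u ∈ C, ∀ v ∈ C, star u ⬝ᵥ (A *ᵥ v) = c * (star u ⬝ᵥ v)) {u v : Config Λ → ℂ}
    (hu : u ∈ C) (hv : v ∈ C) :
    star u ⬝ᵥ (A *ᵥ (B *ᵥ v)) = c * (star u ⬝ᵥ (B *ᵥ v)) := by
  classical
  -- `Q₁` is the product of the projectors that commute with `B`, and `Q₂` that of the others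
  obtain ⟨Q₁, hQ₁s, hQ₁v, hQ₁m, hQ₁c⟩ := exists_prod_projectors (Ps.filter fun P => Commute P B)
    (fun P hP => hproj P (Finset.mem_filter.mp hP).1)
    fun P hP Q hQ => hcomm P (Finset.mem_filter.mp hP).1 Q (Finset.mem_filter.mp hQ).1
  obtain ⟨Q₂, hQ₂s, hQ₂v, hQ₂m, hQ₂c⟩ := exists_prod_projectors (Ps.filter fun P => ¬ Commute P B)
    (fun P hP => hproj P (Finset.mem_filter.mp hP).1)
    fun P hP Q hQ => hcomm P (Finset.mem_filter.mp hP).1 Q (Finset.mem_filter.mp hQ).1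
  have hQB : Commute Q₁ B := hQ₁c B fun P hP => (Finset.mem_filter.mp hP).2
  have hQA : Commute Q₂ A := hQ₂c A fun P hP =>
    (hAB P (Finset.mem_filter.mp hP).1).resolve_right (Finset.mem_filter.mp hP).2
  have hQ₁C : ∀ x ∈ C, Q₁ *ᵥ x = x := fun x hx =>
    hQ₁v x fun P hP => (hC x).mp hx P (Finset.mem_filter.mp hP).1
  have hQ₂C : ∀ x ∈ C, Q₂ *ᵥ x = x := fun x hx =>
    hQ₂v x fun P hP => (hC x).mp hx P (Finset.mem_filter.mp hP).1
  have hmem : ∀ x, Q₂ *ᵥ (Q₁ *ᵥ x) ∈ C := by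
    refine fun x => (hC _).mpr fun P hP => ?_
    by_cases hPB : Commute P B
    · have h1 : Commute Q₂ P := hQ₂c P fun Q hQ => hcomm Q (Finset.mem_filter.mp hQ).1 P hP
      rw [Matrix.mulVec_mulVec, ← h1.eq, ← Matrix.mulVec_mulVec, Matrix.mulVec_mulVec _ P,
        hQ₁m P (Finset.mem_filter.mpr ⟨hP, hPB⟩)]
    · rw [Matrix.mulVec_mulVec, hQ₂m P (Finset.mem_filter.mpr ⟨hP, hPB⟩)]
  have hmove₂ : ∀ x, star u ⬝ᵥ (Q₂ *ᵥ x) = star u ⬝ᵥ x := fun x => by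
    conv_rhs => rw [← hQ₂C u hu]
    rw [star_mulVec_dotProduct, hQ₂s]
  have hmove₁ : ∀ x, star u ⬝ᵥ (Q₁ *ᵥ x) = star u ⬝ᵥ x := fun x => by
    conv_rhs => rw [← hQ₁C u hu]
    rw [star_mulVec_dotProduct, hQ₁s]
  have hBv : Q₁ *ᵥ (B *ᵥ v) = B *ᵥ v := by
    rw [Matrix.mulVec_mulVec, hQB.eq, ← Matrix.mulVec_mulVec, hQ₁C v hv]
  have hA : Q₂ *ᵥ (A *ᵥ (B *ᵥ v)) = A *ᵥ (Q₂ *ᵥ (Q₁ *ᵥ (B *ᵥ v))) := by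
    rw [hBv, Matrix.mulVec_mulVec, hQA.eq, ← Matrix.mulVec_mulVec]
  rw [← hmove₂, hA, hc u hu _ (hmem _), hmove₂, hmove₁]

/-- Two disjoint correctable sets such that no projector acts on both have a correctable union. -/
lemma KnillLaflamme.union {C : Submodule ℂ (Config Λ → ℂ)} {Ps : Finset (Operator Λ)}
    (hproj : ∀ P ∈ Ps, IsStarProjection P) (hcomm : ∀ P ∈ Ps, ∀ Q ∈ Ps, Commute P Q)
    (hC : ∀ v, v ∈ C ↔ ∀ P ∈ Ps, P *ᵥ v = v) {M N : Finset Λ} (hMN : Disjoint M N)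
    (hM : KnillLaflamme C M) (hN : KnillLaflamme C N)
    (h : ∀ P ∈ Ps, SupportedOn P Mᶜ ∨ SupportedOn P Nᶜ) : KnillLaflamme C (M ∪ N) := by
  intro O hO
  have hunit := fun m m' => hM _ (supportedOn_unitOn M m m')
  have hdiff : (M ∪ N) \ M = N := by rw [Finset.union_sdiff_left, hMN.sdiff_eq_right]
  have hblockN : ∀ m m', SupportedOn (blockOn M m m' O) N := fun m m' =>
    hdiff ▸ supportedOn_blockOn m m' hO
  have hblock := fun m m' => hN _ (hblockN m m')
  choose a ha using hunit
  choose b hb using hblock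
  refine ⟨∑ m, ∑ m', a m m' * b m m', fun u hu v hv => ?_⟩
  conv_lhs => rw [eq_sum_unitOn_mul_blockOn M O]
  simp only [Matrix.sum_mulVec, dotProduct_sum, Finset.sum_mul]
  refine Finset.sum_congr rfl fun m _ => Finset.sum_congr rfl fun m' _ => ?_
  rw [← Matrix.mulVec_mulVec, star_dotProduct_mulVec_mulVec hproj hcomm hC (fun P hP => ?_)
    (ha m m') hu hv, hb m m' u hu v hv, mul_assoc]
  exact (h P hP).imp (fun hPM => hPM.commute (supportedOn_unitOn M m m') disjoint_compl_left)
    fun hPN => hPN.commute (hblockN m m') disjoint_compl_left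

/-- Expansion lemma: a correctable set `M` can be enlarged by a correctable set `A` that contains
all qubits outside `M` on which a projector touching `M` acts. -/
lemma KnillLaflamme.expand {C : Submodule ℂ (Config Λ → ℂ)} {Ps : Finset (Operator Λ)}
    (hproj : ∀ P ∈ Ps, IsStarProjection P) (hcomm : ∀ P ∈ Ps, ∀ Q ∈ Ps, Commute P Q)
    (hC : ∀ v, v ∈ C ↔ ∀ P ∈ Ps, P *ᵥ v = v) {M A : Finset Λ}
    (hM : KnillLaflamme C M) (hA : KnillLaflamme C A)
    (h : ∀ P ∈ Ps, SupportedOn P Mᶜ ∨ SupportedOn P (M ∪ A)) : KnillLaflamme C (M ∪ A) := by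
  intro O hO
  set B : Finset Λ := (M ∪ A)ᶜ with hB
  -- the code spanned by the code states after arbitrary operations on `B`
  set E : Submodule ℂ (Config Λ → ℂ) :=
    Submodule.span ℂ {x | ∃ P, SupportedOn P B ∧ ∃ v ∈ C, P *ᵥ v = x} with hE
  have hCE : C ≤ E := fun v hv =>
    Submodule.subset_span ⟨1, supportedOn_one B, v, hv, Matrix.one_mulVec v⟩
  have hBE : ∀ P, SupportedOn P B → ∀ x ∈ E, P *ᵥ x ∈ E := by
    intro P hP x hx
    induction hx using Submodule.span_induction with
    | mem x hx =>
      obtain ⟨P', hP', v, hv, rfl⟩ := hx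
      exact Submodule.subset_span ⟨P * P', hP.mul hP', v, hv, (Matrix.mulVec_mulVec ..).symm⟩
    | zero => rw [Matrix.mulVec_zero]; exact E.zero_mem
    | add x y _ _ hx hy => rw [Matrix.mulVec_add]; exact E.add_mem hx hy
    | smul a x _ hx => rw [Matrix.mulVec_smul]; exact E.smul_mem a hx
  have hdisj : Disjoint M B := by
    rw [hB, Finset.disjoint_left]
    intro i hi
    simp [hi]
  -- decoupling: `M` stays correctable for this larger code
  have hME : KnillLaflamme E M := by
    intro P hP
    obtain ⟨c, hc⟩ := hM P hP
    refine ⟨c, fun x hx y hy => ?_⟩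
    induction hx, hy using Submodule.span_induction₂ with
    | mem_mem x y hx hy =>
      obtain ⟨S, hS, u, hu, rfl⟩ := hx
      obtain ⟨T, hT, v, hv, rfl⟩ := hy
      have hST : SupportedOn (Sᴴ * T) B := hS.conjTranspose.mul hT
      rw [star_mulVec_dotProduct, star_mulVec_dotProduct, Matrix.mulVec_mulVec,
        ← (hP.commute hS.conjTranspose hdisj).eq, ← Matrix.mulVec_mulVec, Matrix.mulVec_mulVec _ Sᴴ]
      refine star_dotProduct_mulVec_mulVec hproj hcomm hC (fun Q hQ => ?_) hc hu hv
      exact (h Q hQ).imp (fun hQM => hQM.commute hP disjoint_compl_left)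
        fun hQMA => hQMA.commute hST disjoint_compl_right
    | zero_left y hy => simp
    | zero_right x hx => simp
    | add_left x y z _ _ _ hx hy => rw [star_add, add_dotProduct, add_dotProduct, hx, hy, mul_add]
    | add_right x y z _ _ _ hx hy =>
      rw [Matrix.mulVec_add, dotProduct_add, dotProduct_add, hx, hy, mul_add]
    | smul_left r x y _ _ hx =>
      rw [star_smul, smul_dotProduct, smul_dotProduct, hx, smul_eq_mul, smul_eq_mul]; ring
    | smul_right r x y _ _ hx =>
      rw [Matrix.mulVec_smul, dotProduct_smul, dotProduct_smul, hx, smul_eq_mul, smul_eq_mul]; ring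
  obtain ⟨Q, hQs, hQE, hQ⟩ := exists_projection E
  have hQB : ∀ P, SupportedOn P B → Commute Q P := by
    have hQPQ : ∀ P, SupportedOn P B → Q * P * Q = P * Q := by
      intro P hP
      refine ext_of_star_dotProduct fun u v => ?_
      rw [← Matrix.mulVec_mulVec, ← Matrix.mulVec_mulVec, hQ _ (hBE P hP _ (hQE v)),
        Matrix.mulVec_mulVec]
    intro P hP
    have := congrArg Matrix.conjTranspose (hQPQ _ hP.conjTranspose)
    simp only [Matrix.conjTranspose_mul, Matrix.conjTranspose_conjTranspose, hQs] at this
    exact this.symm.trans (by rw [← Matrix.mul_assoc, hQPQ P hP])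
  have hXB : ∀ P, SupportedOn P B → Commute (Q * O) P := fun P hP =>
    (hQB P hP).mul_left (hO.commute hP disjoint_compl_right)
  obtain ⟨Y, hYM, hYE⟩ := hME.exists_equivalent (X := Q * O) fun x _ => by
    rw [← Matrix.mulVec_mulVec]; exact hQE _
  -- `Q * O` commutes with the operators on `B`, so `Y` can be made to act trivially on `B`
  have hZ : SupportedOn (blockOn B 0 0 Y) A := by
    refine (supportedOn_blockOn 0 0 hYM).mono fun i hi => ?_
    simp only [hB, Finset.mem_sdiff, Finset.mem_compl, Finset.mem_union, not_not] at hi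
    exact hi.2.resolve_left hi.1
  have hZE : ∀ v ∈ E, blockOn B 0 0 Y *ᵥ v = (Q * O) *ᵥ v := by
    intro v hv
    have hterm : ∀ b, (unitOn B b 0 * Y * unitOn B 0 b) *ᵥ v = (Q * O) *ᵥ (unitOn B b b *ᵥ v) := by
      intro b
      rw [← Matrix.mulVec_mulVec, ← Matrix.mulVec_mulVec,
        ← hYE _ (hBE _ (supportedOn_unitOn B 0 b) v hv), Matrix.mulVec_mulVec,
        ← (hXB _ (supportedOn_unitOn B b 0)).eq, ← Matrix.mulVec_mulVec, Matrix.mulVec_mulVec _ _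
        (unitOn B 0 b), unitOn_mul_unitOn, if_pos rfl]
    rw [blockOn, Matrix.sum_mulVec, Finset.sum_congr rfl fun b _ => hterm b, ← Matrix.mulVec_sum,
      ← Matrix.sum_mulVec, sum_unitOn, Matrix.one_mulVec]
  obtain ⟨c, hc⟩ := hA _ hZ
  refine ⟨c, fun u hu v hv => ?_⟩
  rw [← hc u hu v hv, hZE v (hCE hv), ← Matrix.mulVec_mulVec]
  conv_lhs => rw [← hQ u (hCE hu), star_mulVec_dotProduct, hQs]

end CommutingProjectors

/-! ### Counting sites of the lattice -/

section Counting

variable {D L : ℕ}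

lemma card_filter_fin_Ico_le (a b : ℕ) :
    (Finset.univ.filter fun y : Fin L => a ≤ (y : ℕ) ∧ (y : ℕ) < b).card ≤ b - a := by
  rw [← Nat.card_Ico]
  exact Finset.card_le_card_of_injOn Fin.val (fun y hy => by simpa using hy)
    Fin.val_injective.injOn

/-- The number of sites in a box with sides `I j`, each of size at most `l`, one of whose
coordinates lies in an exceptional set of size at most `u`. -/
lemma card_filter_exists_mem_le (I J : Fin D → Finset (Fin L)) (l u : ℕ)
    (hI : ∀ j, (I j).card ≤ l) (hJ : ∀ j, (J j).card ≤ u) :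
    (Finset.univ.filter fun x : Site D L => (∀ j, x j ∈ I j) ∧ ∃ j, x j ∈ J j).card ≤
      D * (u * l ^ (D - 1)) := by
  have hsub : (Finset.univ.filter fun x : Site D L => (∀ j, x j ∈ I j) ∧ ∃ j, x j ∈ J j) ⊆
      Finset.univ.biUnion fun j => Fintype.piFinset fun k => if k = j then J k else I k := by
    intro x hx
    obtain ⟨hxI, j, hxJ⟩ := (Finset.mem_filter.mp hx).2
    refine Finset.mem_biUnion.mpr ⟨j, Finset.mem_univ _, Fintype.mem_piFinset.mpr fun k => ?_⟩
    split_ifs with hk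
    · exact hk ▸ hxJ
    · exact hxI k
  refine (Finset.card_le_card hsub).trans (Finset.card_biUnion_le.trans ?_)
  have hterm : ∀ j : Fin D,
      (Fintype.piFinset fun k => if k = j then J k else I k).card ≤ u * l ^ (D - 1) := by
    intro j
    rw [Fintype.card_piFinset, ← Finset.mul_prod_erase _ _ (Finset.mem_univ j), if_pos rfl]
    refine Nat.mul_le_mul (hJ j) ?_
    calc ∏ k ∈ Finset.univ.erase j, (if k = j then J k else I k).card
        ≤ ∏ _k ∈ Finset.univ.erase j, l := by
          refine Finset.prod_le_prod' fun k hk => ?_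
          rw [if_neg (Finset.ne_of_mem_erase hk)]
          exact hI k
      _ = l ^ (D - 1) := by simp
  calc _ ≤ ∑ _j : Fin D, u * l ^ (D - 1) := Finset.sum_le_sum fun j _ => hterm j
    _ = D * (u * l ^ (D - 1)) := by simp

end Counting

/-! ### Correctable boxes -/

section Boxes

variable {D L w : ℕ} {bc : Boundary}

/-- In a coordinate in which a site is at least `w` away from both ends of the lattice, the
hypercubes of size `w` through this site do not wrap around. -/
lemma lt_add_of_mem_hypercube {a : Fin D → ℕ} {x y : Site D L} (hx : x ∈ hypercube bc w a)
    (hy : y ∈ hypercube bc w a) (j : Fin D) (h1 : w ≤ (x j : ℕ)) (h2 : (x j : ℕ) + w ≤ L) :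
    (x j : ℕ) < y j + w ∧ (y j : ℕ) < x j + w := by
  cases bc with
  | openBoundary =>
    obtain ⟨k, hk, hxk⟩ := (Finset.mem_filter.mp hx).2 j
    obtain ⟨k', hk', hyk⟩ := (Finset.mem_filter.mp hy).2 j
    omega
  | periodicBoundary =>
    obtain ⟨k, hk, hxk⟩ := (Finset.mem_filter.mp hx).2 j
    obtain ⟨k', hk', hyk⟩ := (Finset.mem_filter.mp hy).2 j
    have h3 : a j + k' = ((x j : ℕ) + k' - k) + L * ((a j + k) / L) := by
      have := Nat.mod_add_div (a j + k) L
      omega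
    have h4 : (y j : ℕ) = (x j : ℕ) + k' - k := by
      rw [hyk, h3, Nat.add_mul_mod_self_left, Nat.mod_eq_of_lt (by omega)]
    omega

/-- The box `∏ j, [p j, q j)` with a margin of width `n` removed on all sides. -/
def erodedBox (p q : Fin D → ℕ) (n : ℕ) : Finset (Site D L) :=
  Finset.univ.filter fun x => ∀ j, p j + n ≤ (x j : ℕ) ∧ (x j : ℕ) + n < q j

lemma mem_erodedBox {p q : Fin D → ℕ} {n : ℕ} {x : Site D L} :
    x ∈ erodedBox p q n ↔ ∀ j, p j + n ≤ (x j : ℕ) ∧ (x j : ℕ) + n < q j := by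
  simp [erodedBox]

lemma hypercube_subset_erodedBox {p q : Fin D → ℕ} {n : ℕ} (hq : ∀ j, q j ≤ L) {a : Fin D → ℕ}
    {x : Site D L} (hx : x ∈ erodedBox p q (n + w)) (hxa : x ∈ hypercube bc w a) :
    hypercube bc w a ⊆ erodedBox (L := L) p q n := by
  intro y hy
  rw [mem_erodedBox] at hx ⊢
  intro j
  have := hx j
  have := hq j
  have := lt_add_of_mem_hypercube hxa hy j (by omega) (by omega)
  omega

lemma card_erodedBox_sdiff_le {p q : Fin D → ℕ} {l : ℕ} (hpq : ∀ j, q j ≤ p j + l) (n : ℕ) :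
    (erodedBox p q n \ erodedBox (L := L) p q (n + w)).card ≤ D * (2 * w * l ^ (D - 1)) := by
  refine (Finset.card_le_card ?_).trans (card_filter_exists_mem_le
    (fun j => Finset.univ.filter fun y : Fin L => p j ≤ (y : ℕ) ∧ (y : ℕ) < q j)
    (fun j => (Finset.univ.filter fun y : Fin L => p j + n ≤ (y : ℕ) ∧ (y : ℕ) < p j + n + w) ∪
      Finset.univ.filter fun y : Fin L => q j - n - w ≤ (y : ℕ) ∧ (y : ℕ) < q j - n)
    l (2 * w) (fun j => ?_) fun j => ?_)
  · intro x hx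
    rw [Finset.mem_sdiff, mem_erodedBox, mem_erodedBox, not_forall] at hx
    obtain ⟨h1, j, h2⟩ := hx
    simp only [Finset.mem_filter, Finset.mem_univ, true_and, Finset.mem_union]
    refine ⟨fun k => ?_, j, ?_⟩
    · have := h1 k
      omega
    · have := h1 j
      omega
  · have := hpq j
    exact (card_filter_fin_Ico_le _ _).trans (by omega)
  · refine (Finset.card_union_le _ _).trans ?_
    have h1 := card_filter_fin_Ico_le (L := L) (p j + n) (p j + n + w)
    have h2 := card_filter_fin_Ico_le (L := L) (q j - n - w) (q j - n)
    omega

lemma LocalCommutingProjectorCode.exists_supportedOn (S : LocalCommutingProjectorCode D L w bc)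
    {P : Operator (Site D L)} (hP : P ∈ S.projectors) :
    ∃ a : Fin D → ℕ, ∀ M, hypercube bc w a ⊆ M → SupportedOn P M := by
  obtain ⟨a, ha⟩ := S.isLocal P hP
  exact ⟨a, fun M hM => ha.mono hM⟩

/-- If all sets of fewer than `d` sites are correctable, then so is every box of side `l` for
which the bound on the size of its boundary layer is below `d`: it is built up from its center by
adding layers of width `w`. -/
lemma LocalCommutingProjectorCode.knillLaflamme_erodedBox
    (S : LocalCommutingProjectorCode D L w bc) {d : ℕ}
    (hd : ∀ M : Finset (Site D L), M.card < d → KnillLaflamme S.codeSpace M) (hw : 0 < w)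
    (hD : 0 < D) {p q : Fin D → ℕ} {l : ℕ} (hq : ∀ j, q j ≤ L) (hpq : ∀ j, q j ≤ p j + l)
    (hl : D * (2 * w * l ^ (D - 1)) < d) :
    KnillLaflamme S.codeSpace (erodedBox p q 0) := by
  have key : ∀ t n, l ≤ n + t * w → KnillLaflamme S.codeSpace (erodedBox p q n) := by
    intro t
    induction t with
    | zero =>
      intro n hn
      refine (knillLaflamme_empty _).mono fun x hx => ?_
      have := mem_erodedBox.mp hx ⟨0, hD⟩
      have := hpq ⟨0, hD⟩
      omega
    | succ t ih =>
      intro n hn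
      have hM := ih (n + w) (by rw [Nat.succ_mul] at hn; omega)
      have hA := hd _ ((card_erodedBox_sdiff_le (w := w) (L := L) hpq n).trans_lt hl)
      have hcover : erodedBox (L := L) p q n ⊆
          erodedBox p q (n + w) ∪ (erodedBox p q n \ erodedBox p q (n + w)) := by
        intro x hx
        by_cases hx' : x ∈ erodedBox p q (n + w) <;> simp [hx, hx']
      refine (hM.expand S.isProjector S.commute (fun _ => Iff.rfl) hA fun P hP => ?_).mono hcover
      obtain ⟨a, ha⟩ := S.exists_supportedOn hP
      by_cases hmeet : ∃ x : Site D L, x ∈ erodedBox p q (n + w) ∧ x ∈ hypercube bc w a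
      · obtain ⟨x, hx, hxa⟩ := hmeet
        exact Or.inr (ha _ ((hypercube_subset_erodedBox hq hx hxa).trans hcover))
      · push Not at hmeet
        exact Or.inl (ha _ fun y hy => Finset.mem_compl.mpr fun hyM => hmeet y hyM hy)
  exact key l 0 (by nlinarith)

end Boxes

/-! ### A correctable array of separated cells -/

section Cells

variable {D L w : ℕ} {bc : Boundary}

/-- The cell with index `κ` of the partition of the lattice into cubes of side `l`, without the
sites in its lower margin of width `w`, and without those close to the upper end of the lattice. -/
def cell (w l : ℕ) (κ : Fin D → ℕ) : Finset (Site D L) :=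
  Finset.univ.filter fun x => ∀ j, (x j : ℕ) / l = κ j ∧ w ≤ (x j : ℕ) % l ∧ (x j : ℕ) + w ≤ L

lemma mem_cell {l : ℕ} {κ : Fin D → ℕ} {x : Site D L} : x ∈ cell w l κ ↔
    ∀ j, (x j : ℕ) / l = κ j ∧ w ≤ (x j : ℕ) % l ∧ (x j : ℕ) + w ≤ L := by
  simp [cell]

lemma not_lt_of_mem_cell {l : ℕ} {κ κ' : Fin D → ℕ} {x y : Site D L}
    (hx : x ∈ cell w l κ) (hy : y ∈ cell w l κ') {a : Fin D → ℕ} (hxa : x ∈ hypercube bc w a)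
    (hya : y ∈ hypercube bc w a) (j : Fin D) : ¬ κ j < κ' j := by
  intro hlt
  obtain ⟨hx1, hx2, hx3⟩ := mem_cell.mp hx j
  obtain ⟨hy1, hy2, hy3⟩ := mem_cell.mp hy j
  have hxd := Nat.mod_add_div (x j : ℕ) l
  have hyd := Nat.mod_add_div (y j : ℕ) l
  have hnear := lt_add_of_mem_hypercube hxa hya j (by omega) hx3
  rcases Nat.eq_zero_or_pos l with rfl | hl
  · rw [Nat.div_zero] at hx1 hy1
    omega
  have hxl := Nat.mod_lt (x j : ℕ) hl
  rw [hx1] at hxd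
  rw [hy1] at hyd
  have : l * κ j + l ≤ l * κ' j := by nlinarith
  omega

lemma eq_of_mem_cell {l : ℕ} {κ κ' : Fin D → ℕ} {x y : Site D L}
    (hx : x ∈ cell w l κ) (hy : y ∈ cell w l κ') {a : Fin D → ℕ} (hxa : x ∈ hypercube bc w a)
    (hya : y ∈ hypercube bc w a) : κ = κ' := by
  funext j
  have h1 := not_lt_of_mem_cell hx hy hxa hya j
  have h2 := not_lt_of_mem_cell hy hx hya hxa j
  omega

lemma LocalCommutingProjectorCode.knillLaflamme_biUnion_cell
    (S : LocalCommutingProjectorCode D L w bc) {l : ℕ}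
    (h : ∀ κ, KnillLaflamme S.codeSpace (cell w l κ)) (T : Finset (Fin D → ℕ)) :
    KnillLaflamme S.codeSpace (T.biUnion (cell w l)) := by
  induction T using Finset.induction_on with
  | empty => exact knillLaflamme_empty _
  | insert κ T hκ ih =>
    rw [Finset.biUnion_insert]
    refine (h κ).union S.isProjector S.commute (fun _ => Iff.rfl) ?_ ih fun P hP => ?_
    · rw [Finset.disjoint_left]
      intro x hx hx'
      obtain ⟨κ', hκ', hx'⟩ := Finset.mem_biUnion.mp hx'
      have : κ = κ' := funext fun j => ((mem_cell.mp hx j).1).symm.trans (mem_cell.mp hx' j).1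
      exact hκ (this ▸ hκ')
    · obtain ⟨a, ha⟩ := S.exists_supportedOn hP
      by_cases hmeet : ∃ x : Site D L, x ∈ cell w l κ ∧ x ∈ hypercube bc w a
      · obtain ⟨x, hx, hxa⟩ := hmeet
        refine Or.inr (ha _ fun y hy => Finset.mem_compl.mpr fun hyT => ?_)
        obtain ⟨κ', hκ', hyκ'⟩ := Finset.mem_biUnion.mp hyT
        exact hκ (eq_of_mem_cell hx hyκ' hxa hy ▸ hκ')
      · push Not at hmeet
        exact Or.inl (ha _ fun y hy => Finset.mem_compl.mpr fun hyM => hmeet y hyM hy)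

/-- The union of all cells. -/
def cells (w l : ℕ) : Finset (Site D L) :=
  Finset.univ.filter fun x => ∀ j, w ≤ (x j : ℕ) % l ∧ (x j : ℕ) + w ≤ L

lemma LocalCommutingProjectorCode.knillLaflamme_cells
    (S : LocalCommutingProjectorCode D L w bc) {d : ℕ}
    (hd : ∀ M : Finset (Site D L), M.card < d → KnillLaflamme S.codeSpace M) (hw : 0 < w)
    (hD : 0 < D) {l : ℕ} (hl0 : 0 < l) (hl : D * (2 * w * l ^ (D - 1)) < d) :
    KnillLaflamme S.codeSpace (cells w l) := by
  have hcell : ∀ κ, KnillLaflamme S.codeSpace (cell w l κ) := by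
    intro κ
    refine (S.knillLaflamme_erodedBox hd hw hD (p := fun j => l * κ j)
      (q := fun j => min (l * κ j + l) L) (fun j => min_le_right _ _) (fun j => min_le_left _ _)
      hl).mono fun x hx => mem_erodedBox.mpr fun j => ?_
    obtain ⟨h1, -, -⟩ := mem_cell.mp hx j
    have h2 := Nat.mod_add_div (x j : ℕ) l
    have h3 := Nat.mod_lt (x j : ℕ) hl0
    have h4 := (x j).isLt
    rw [h1] at h2
    rw [lt_min_iff]
    omega
  refine (S.knillLaflamme_biUnion_cell hcell
    (Finset.univ.image fun (x : Site D L) j => (x j : ℕ) / l)).mono fun x hx => ?_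
  refine Finset.mem_biUnion.mpr
    ⟨_, Finset.mem_image_of_mem _ (Finset.mem_univ x), mem_cell.mpr fun j => ⟨rfl, ?_⟩⟩
  exact (Finset.mem_filter.mp hx).2 j

lemma card_compl_cells_le (l : ℕ) :
    ((cells w l : Finset (Site D L))ᶜ).card ≤ D * (((L / l + 1) * w + w) * L ^ (D - 1)) := by
  refine (Finset.card_le_card ?_).trans (card_filter_exists_mem_le (fun _ => Finset.univ)
    (fun _ => (Finset.univ.filter fun y : Fin L => (y : ℕ) % l < w) ∪
      Finset.univ.filter fun y : Fin L => L - w ≤ (y : ℕ) ∧ (y : ℕ) < L)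
    L ((L / l + 1) * w + w) (fun _ => by simp) fun _ => ?_)
  · intro x hx
    rw [Finset.mem_compl, cells, Finset.mem_filter, not_and, not_forall] at hx
    obtain ⟨j, hj⟩ := hx (Finset.mem_univ _)
    simp only [Finset.mem_filter, Finset.mem_univ, true_and, Finset.mem_union]
    refine ⟨fun _ => trivial, j, ?_⟩
    have := (x j).isLt
    omega
  · refine (Finset.card_union_le _ _).trans (Nat.add_le_add ?_ ?_)
    · rw [← Finset.card_range (L / l + 1), ← Finset.card_range w, ← Finset.card_product]
      simp only [Finset.card_range]
      refine Finset.card_le_card_of_injOn (fun y : Fin L => ((y : ℕ) / l, (y : ℕ) % l)) ?_ ?_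
      · intro y hy
        have h1 : (y : ℕ) / l ≤ L / l := Nat.div_le_div_right y.isLt.le
        have h2 : (y : ℕ) % l < w := by simpa using hy
        simp only [Finset.coe_product, Set.mem_prod, Finset.coe_range, Set.mem_Iio]
        omega
      · intro y _ z _ hyz
        simp only [Prod.mk.injEq] at hyz
        ext
        rw [← Nat.mod_add_div (y : ℕ) l, ← Nat.mod_add_div (z : ℕ) l, hyz.1, hyz.2]
    · exact (card_filter_fin_Ico_le _ _).trans (by omega)

end Cells

/-! ### The tradeoff -/

section Tradeoff

variable {D L w : ℕ} {bc : Boundary}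

lemma IsDistance.knillLaflamme {Λ : Type} [Fintype Λ] [DecidableEq Λ]
    {C : Submodule ℂ (Config Λ → ℂ)} {d : ℕ} (hd : IsDistance C d) {M : Finset Λ}
    (hM : M.card < d) : KnillLaflamme C M := by
  refine IsCorrectable.knillLaflamme ?_
  by_contra h
  exact absurd (hd.2 ⟨M, h, rfl⟩) (not_le.mpr hM)

lemma IsDistance.not_knillLaflamme_univ {Λ : Type} [Fintype Λ] [DecidableEq Λ]
    {C : Submodule ℂ (Config Λ → ℂ)} {d : ℕ} (hd : IsDistance C d) :
    ¬ KnillLaflamme C Finset.univ := by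
  obtain ⟨M, hM, -⟩ := hd.1
  exact fun h => hM (isCorrectable_of_knillLaflamme_univ h M)

/-- If the distance were larger, then the whole lattice would be a correctable box. -/
lemma LocalCommutingProjectorCode.distance_le (S : LocalCommutingProjectorCode D L w bc) {d : ℕ}
    (hd : IsDistance S.codeSpace d) (hw : 0 < w) (hD : 0 < D) :
    d ≤ D * (2 * w * L ^ (D - 1)) := by
  by_contra hlt
  push Not at hlt
  refine hd.not_knillLaflamme_univ ((S.knillLaflamme_erodedBox (fun M hM => hd.knillLaflamme hM)
    hw hD (p := fun _ => 0) (q := fun _ => L) (fun _ => le_rfl) (fun _ => by simp) hlt).mono ?_)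
  intro x _
  exact mem_erodedBox.mpr fun j => ⟨by simp, (x j).isLt⟩

end Tradeoff

end QubitCode

open QubitCode
theorem theorem2 (D w : ℕ) (hD : 2 ≤ D) (hw : 1 < w) :
    ∃ c : ℝ, 0 < c ∧
      ∀ (L : ℕ) (bc : Boundary) (S : LocalCommutingProjectorCode D L w bc) (d : ℕ),
        IsDistance S.codeSpace d →
          (∀ W : Operator (Site D L), IsLogical S.codeSpace W →
            ∃ V : Operator (Site D L), IsLogical S.codeSpace V ∧ Equivalent S.codeSpace W V ∧
              (weight V : ℝ) * (d : ℝ) ^ ((1 : ℝ) / ((D : ℝ) - 1)) < c * (L : ℝ) ^ D) ∧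
          (d : ℝ) ≤ c * (L : ℝ) ^ (D - 1) := by
  have hD0 : 0 < D := by omega
  have hw0 : 0 < w := by omega
  -- `K * l ^ (D - 1)` bounds the size of the boundary layer of a box of side `l`
  set K : ℝ := 2 * w * D with hK
  have hK1 : 1 ≤ K := by
    have h1 : (1 : ℝ) ≤ w := by exact_mod_cast hw0
    have h2 : (1 : ℝ) ≤ D := by exact_mod_cast hD0
    nlinarith
  refine ⟨6 * K ^ 2 + 2 * K + 1, by positivity, fun L bc S d hd => ?_⟩
  have hL : 0 < L := by
    rcases Nat.eq_zero_or_pos L with rfl | hL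
    · refine absurd ((knillLaflamme_empty S.codeSpace).mono fun x _ => ?_)
        hd.not_knillLaflamme_univ
      exact (x ⟨0, hD0⟩).elim0
    · exact hL
  have hLR : (1 : ℝ) ≤ L := by exact_mod_cast hL
  have hdist := S.distance_le hd hw0 hD0
  have hdistR : (d : ℝ) ≤ K * (L : ℝ) ^ (D - 1) := by
    have : (d : ℝ) ≤ ((D * (2 * w * L ^ (D - 1)) : ℕ) : ℝ) := by exact_mod_cast hdist
    refine this.trans (le_of_eq ?_)
    push_cast
    rw [hK]; ring
  refine ⟨fun W hW => ?_, hdistR.trans ?_⟩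
  swap
  · gcongr
    nlinarith
  set y : ℝ := (d : ℝ) ^ ((1 : ℝ) / ((D : ℝ) - 1)) with hy
  have hy0 : 0 ≤ y := by positivity
  have hyn : y ^ (D - 1) = d := by
    have hcast : (1 : ℝ) / ((D : ℝ) - 1) = ((D - 1 : ℕ) : ℝ)⁻¹ := by
      rw [Nat.cast_sub hD0, Nat.cast_one, one_div]
    rw [hy, hcast]
    exact Real.rpow_inv_natCast_pow (Nat.cast_nonneg d) (by omega)
  have hLD : (1 : ℝ) ≤ (L : ℝ) ^ D := one_le_pow₀ hLR
  rcases le_or_gt y (2 * K) with hyK | hyK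
  · -- bounded distance: every weight is at most the number of sites
    refine ⟨W, hW, fun _ _ => rfl, ?_⟩
    have hweight : (weight W : ℝ) ≤ (L : ℝ) ^ D := by
      have h1 : weight W ≤ (Finset.univ : Finset (Site D L)).card :=
        Finset.card_le_card (Finset.subset_univ _)
      rw [Finset.card_univ, Fintype.card_fun, Fintype.card_fin, Fintype.card_fin] at h1
      exact_mod_cast h1
    calc (weight W : ℝ) * y ≤ (L : ℝ) ^ D * (2 * K) := by gcongr
      _ < (6 * K ^ 2 + 2 * K + 1) * (L : ℝ) ^ D := by nlinarith [sq_nonneg K]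
  -- the side of the cells
  set l : ℕ := ⌊y / (2 * K)⌋₊ with hl
  have hK0 : 0 < 2 * K := by linarith
  have hl1 : 1 ≤ l := Nat.le_floor (by rw [Nat.cast_one, le_div_iff₀ hK0]; linarith)
  have hl1R : (1 : ℝ) ≤ l := by exact_mod_cast hl1
  have hly : (l : ℝ) ≤ y / (2 * K) := Nat.floor_le (by positivity)
  have hyl : y ≤ 4 * K * l := by
    have h1 : y / (2 * K) < l + 1 := Nat.lt_floor_add_one _
    rw [div_lt_iff₀ hK0] at h1
    nlinarith
  have hd0 : (0 : ℝ) < d := by rw [← hyn]; exact pow_pos (by linarith) _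
  have hboxR : K * (l : ℝ) ^ (D - 1) < d := by
    have h1 : (l : ℝ) ^ (D - 1) ≤ d / (2 * K) ^ (D - 1) := by
      rw [← hyn, ← div_pow]
      gcongr
    have h2 : 2 * K ≤ (2 * K) ^ (D - 1) := le_self_pow₀ (by linarith) (by omega)
    calc K * (l : ℝ) ^ (D - 1) ≤ K * (d / (2 * K)) := by
          gcongr
          exact h1.trans (by gcongr)
      _ = d / 2 := by field_simp
      _ < d := by linarith
  have hbox : D * (2 * w * l ^ (D - 1)) < d := by
    have h1 : ((D * (2 * w * l ^ (D - 1)) : ℕ) : ℝ) < d := by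
      refine lt_of_eq_of_lt ?_ hboxR
      push_cast
      rw [hK]; ring
    exact_mod_cast h1
  have hlL : l ≤ L := by
    by_contra hlt
    push Not at hlt
    have : D * (2 * w * L ^ (D - 1)) ≤ D * (2 * w * l ^ (D - 1)) := by gcongr
    omega
  obtain ⟨V, hV, hWV⟩ := (S.knillLaflamme_cells (fun M hM => hd.knillLaflamme hM) hw0 hD0
    hl1 hbox).exists_equivalent hW
  refine ⟨V, fun ψ hψ => hWV ψ hψ ▸ hW ψ hψ, hWV, ?_⟩
  have hweight : (weight V : ℝ) ≤ 3 * w * D * ((L : ℝ) ^ D / l) := by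
    have h1 : (weight V : ℝ) ≤ ((D * (((L / l + 1) * w + w) * L ^ (D - 1)) : ℕ) : ℝ) := by
      exact_mod_cast (weight_le_card hV).trans (card_compl_cells_le l)
    have h2 : ((L / l : ℕ) : ℝ) ≤ (L : ℝ) / l := Nat.cast_div_le
    have h3 : (1 : ℝ) ≤ (L : ℝ) / l := by
      rw [le_div_iff₀ (by linarith), one_mul]
      exact_mod_cast hlL
    have h4 : (L : ℝ) ^ D = L * (L : ℝ) ^ (D - 1) := by
      rw [← pow_succ']
      congr 1
      omega
    refine h1.trans ?_
    push_cast
    calc (D : ℝ) * (((((L / l : ℕ) : ℝ) + 1) * w + w) * (L : ℝ) ^ (D - 1))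
        ≤ D * ((((L : ℝ) / l + (L : ℝ) / l) * w + (L : ℝ) / l * w) * (L : ℝ) ^ (D - 1)) := by
          gcongr
          exact le_mul_of_one_le_left (by positivity) h3
      _ = 3 * w * D * ((L : ℝ) ^ D / l) := by rw [h4]; ring
  calc (weight V : ℝ) * y ≤ 3 * w * D * ((L : ℝ) ^ D / l) * (4 * K * l) := by gcongr
    _ = 6 * K ^ 2 * (L : ℝ) ^ D := by rw [hK]; field_simp; ring
    _ < (6 * K ^ 2 + 2 * K + 1) * (L : ℝ) ^ D := by nlinarith
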